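/- Let $m\ge 2$ and let $T_m$ be the rooted $m$-adic tree, whose vertices are the finite words on $\{1,\dots,m\}$, with the empty word as root and each $v$ joined to the words $vx$, $x\in\{1,\dots,m\}$. Let $\mathrm{Aut}\,T_m$ be the group of graph automorphisms of $T_m$ fixing the root. For $g\in\mathrm{Aut}\,T_m$ and a vertex $v$, the label of $g$ at $v$ is the permutation $g|_v^1\in\mathrm{Sym}(m)$ such that $g$ sends $vx$ to the word obtained by appending the image of $x$ under $g|_v^1$ to the image of $v$ under $g$. For $H\le \mathrm{Sym}(m)$ let $$W_H=\{g\in\mathrm{Aut}\,T_m \mid g|_v^1\in H\text{ for every vertex } v\}$$ be the iterated permutational wreath product. Let $\mathrm{St}_{W_H}(n)$ be the subgroup of elements of $W_H$ fixing every word of length $n$, and let $\mathcal S=\{\mathrm{St}_{W_H}(n)\}_{n\ge 0}$ be the level-stabilizer filtration. Equip $W_H$ with the topology in which $\mathcal S$ is a neighbourhood basis of the identity, which is also the topology of the metric $d(x,y)=\inf\{|W_H:\mathrm{St}_{W_H}(n)|^{-1} \mid xy^{-1}\in \mathrm{St}_{W_H}(n)\}$ when $H\neq 1$. Let $\mathrm{hdim}^{\mathcal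 S}$ denote Hausdorff dimension with respect to $d$, and let $\mathrm{hspec}^{\mathcal S}(W_H)$, $\mathrm{hspec}^{\mathcal S}_{\mathrm{fg}}(W_H)$ and $\mathrm{hspec}^{\mathcal S}_{b}(W_H)$ be the sets of Hausdorff dimensions of, respectively, all closed subgroups of $W_H$, those that are topologically finitely generated, and those that are topologically generated by at most $b$ elements. **Theorem.** Let $m\ge 2$ and let $H\le\mathrm{Sym}(m)$ be transitive. Then there exists an integer $b\ge 2$ such that $$\mathrm{hspec}^{\mathcal S}_{b}(W_H)=\mathrm{hspec}^{\mathcal S}_{\mathrm{fg}}(W_H)=\mathrm{hspec}^{\mathcal S}(W_H)=[0,1].$$ -/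

import Mathlib

open scoped ENNReal

/-! ### Filtrations of groups, the metric and the topology they induce -/

/-- A filtration series of a group `G`: a descending chain `G = G₀ ⊇ G₁ ⊇ …` of normal subgroups of
finite index with trivial intersection. -/
structure GroupFiltration (G : Type*) [Group G] where
  /-- The terms of the filtration. -/
  term : ℕ → Subgroup G
  term_zero : term 0 = ⊤
  antitone : Antitone term
  normal : ∀ i, (term i).Normal
  finiteIndex : ∀ i, (term i).FiniteIndex
  iInf_eq_bot : ⨅ i, term i = ⊥

namespace GroupFiltration

variable {G : Type*} [Group G] (F : GroupFiltration G)

/-- The distance `inf {|G : Gᵢ|⁻¹ | x y⁻¹ ∈ Gᵢ}`. For infinite `G` this infimum is `0` when `x = y`;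
the case distinction only makes it a distance on finite groups too. -/
noncomputable def distance (x y : G) : ℝ≥0∞ :=
  open Classical in
  if x = y then 0 else ⨅ (i : ℕ) (_ : x * y⁻¹ ∈ F.term i), ((F.term i).index : ℝ≥0∞)⁻¹

/-- The metric on `G` induced by the filtration. -/
@[reducible]
noncomputable def metric : EMetricSpace G where
  edist := F.distance
  edist_self x := by simp [distance]
  edist_comm x y := by
    have h : ∀ i, x * y⁻¹ ∈ F.term i ↔ y * x⁻¹ ∈ F.term i := fun i => by
      rw [← inv_mem_iff]; simp
    by_cases hxy : x = y
    · subst hxy; rfl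
    · simp only [distance, h, hxy, Ne.symm hxy, if_false]
  edist_triangle x y z := by
    simp only [distance]
    by_cases hxz : x = z
    · simp [hxz]
    by_cases hxy : x = y
    · subst hxy; simp
    by_cases hyz : y = z
    · subst hyz; simp
    simp only [hxz, hxy, hyz, if_false]
    simp only [ENNReal.iInf_add, ENNReal.add_iInf]
    refine le_iInf fun j => le_iInf fun hj => le_iInf fun i => le_iInf fun hi => ?_
    have hij : x * z⁻¹ ∈ F.term (min i j) := by
      have h1 := F.antitone (min_le_left i j) hi
      have h2 := F.antitone (min_le_right i j) hj
      simpa [mul_assoc] using mul_mem h1 h2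
    refine (iInf₂_le (min i j) hij).trans ?_
    rcases min_choice i j with h | h <;> rw [h]
    · exact le_self_add
    · exact le_add_self
  eq_of_edist_eq_zero := by
    intro x y h
    by_contra hxy
    change F.distance x y = 0 at h
    simp only [distance, hxy, if_false] at h
    have hne : x * y⁻¹ ∉ ⨅ i, F.term i := by
      rw [F.iInf_eq_bot, Subgroup.mem_bot, mul_inv_eq_one]; exact hxy
    obtain ⟨n, hn⟩ : ∃ n, x * y⁻¹ ∉ F.term n := by
      simpa [Subgroup.mem_iInf] using hne
    have hle : ((F.term n).index : ℝ≥0∞)⁻¹ ≤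
        ⨅ (i : ℕ) (_ : x * y⁻¹ ∈ F.term i), ((F.term i).index : ℝ≥0∞)⁻¹ := by
      refine le_iInf₂ fun i hi => ?_
      have hin : i ≤ n := by
        by_contra hlt
        exact hn (F.antitone (le_of_lt (not_le.mp hlt)) hi)
      have := F.finiteIndex n
      have := Subgroup.index_antitone (F.antitone hin)
      rw [ENNReal.inv_le_inv]
      exact_mod_cast this
    rw [h, nonpos_iff_eq_zero, ENNReal.inv_eq_zero] at hle
    exact ENNReal.natCast_ne_top _ hle

/-- The topology on `G` in which the terms of the filtration form a neighbourhood basis of `1`. -/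
@[reducible]
def topology : TopologicalSpace G where
  IsOpen U := ∀ g ∈ U, ∃ n, ∀ k ∈ F.term n, g * k ∈ U
  isOpen_univ _ _ := ⟨0, fun _ _ => Set.mem_univ _⟩
  isOpen_inter U V hU hV g hg := by
    obtain ⟨a, ha⟩ := hU g hg.1
    obtain ⟨b, hb⟩ := hV g hg.2
    exact ⟨max a b, fun k hk => ⟨ha k (F.antitone (le_max_left a b) hk),
      hb k (F.antitone (le_max_right a b) hk)⟩⟩
  isOpen_sUnion S hS g hg := by
    obtain ⟨U, hU, hgU⟩ := hg
    obtain ⟨n, hn⟩ := hS U hU g hgU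
    exact ⟨n, fun k hk => ⟨U, hU, hn k hk⟩⟩

/-- `K` is a closed subgroup of `G`. -/
def IsClosedSubgroup (K : Subgroup G) : Prop :=
  @IsClosed G F.topology (K : Set G)

/-- `K` is the topological closure of the abstract subgroup generated by `S`. -/
def TopologicallyGenerates (S : Set G) (K : Subgroup G) : Prop :=
  (K : Set G) = @closure G F.topology (Subgroup.closure S : Set G)

/-- The Hausdorff dimension of `K` with respect to the metric induced by the filtration. -/
noncomputable def hdim (K : Subgroup G) : ℝ≥0∞ :=
  @dimH G F.metric (K : Set G)

/-- The Hausdorff spectrum: the Hausdorff dimensions of the closed subgroups. -/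
def hspec : Set ℝ≥0∞ :=
  {d | ∃ K : Subgroup G, F.IsClosedSubgroup K ∧ F.hdim K = d}

/-- The finitely generated Hausdorff spectrum: the Hausdorff dimensions of the topologically finitely
generated closed subgroups. -/
def hspecFG : Set ℝ≥0∞ :=
  {d | ∃ K : Subgroup G, F.IsClosedSubgroup K ∧
    (∃ S : Finset G, F.TopologicallyGenerates (S : Set G) K) ∧ F.hdim K = d}

/-- The `b`-bounded Hausdorff spectrum: the Hausdorff dimensions of the closed subgroups that are
topologically generated by at most `b` elements. -/
def hspecBounded (b : ℕ) : Set ℝ≥0∞ :=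
  {d | ∃ K : Subgroup G, F.IsClosedSubgroup K ∧
    (∃ S : Finset G, S.card ≤ b ∧ F.TopologicallyGenerates (S : Set G) K) ∧ F.hdim K = d}

end GroupFiltration

/-! ### The `m`-adic tree and its automorphisms

Vertices are the finite words on `Fin m`; the root is the empty word and the children of `v` are the
words `v ++ [x]`. -/

/-- The `m`-adic tree as a graph. -/
def adicTree (m : ℕ) : SimpleGraph (List (Fin m)) where
  Adj u v := ∃ x, u = v ++ [x] ∨ v = u ++ [x]
  symm := ⟨fun _ _ ⟨x, h⟩ => ⟨x, h.symm⟩⟩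
  loopless := ⟨fun u ⟨x, h⟩ => by rcases h with h | h <;> simp at h⟩

/-- The automorphism group of the rooted `m`-adic tree: bijections of the vertex set preserving
adjacency and fixing the root. -/
def TreeAut (m : ℕ) : Subgroup (Equiv.Perm (List (Fin m))) where
  carrier := {g | g [] = [] ∧ ∀ u v, (adicTree m).Adj (g u) (g v) ↔ (adicTree m).Adj u v}
  one_mem' := by simp
  mul_mem' := by
    rintro g h ⟨hg, hg'⟩ ⟨hh, hh'⟩
    exact ⟨by simp [hh, hg], fun u v => by simp [hg', hh']⟩
  inv_mem' := by
    rintro g ⟨hg, hg'⟩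
    refine ⟨by rw [Equiv.Perm.inv_eq_iff_eq, hg], fun u v => ?_⟩
    rw [← hg']; simp

namespace TreeAut

variable {m : ℕ}

theorem adj_iff (g : TreeAut m) (u v : List (Fin m)) :
    (adicTree m).Adj (g.1 u) (g.1 v) ↔ (adicTree m).Adj u v := g.2.2 u v

/-- Automorphisms preserve levels and send the parent of a vertex to the parent of its image. -/
theorem exists_child (g : TreeAut m) (v : List (Fin m)) :
    (g.1 v).length = v.length ∧ ∀ x, ∃ y, g.1 (v ++ [x]) = g.1 v ++ [y] := by
  induction v using List.reverseRecOn with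
  | nil =>
    refine ⟨by rw [g.2.1], fun x => ?_⟩
    obtain ⟨y, h | h⟩ := (adj_iff g ([] ++ [x]) []).2 ⟨x, Or.inl rfl⟩
    · exact ⟨y, h⟩
    · rw [g.2.1] at h; simp at h
  | append_singleton u z ih =>
    obtain ⟨w, hw⟩ := ih.2 z
    refine ⟨by rw [hw]; simp [ih.1], fun x => ?_⟩
    obtain ⟨y, h | h⟩ := (adj_iff g (u ++ [z] ++ [x]) (u ++ [z])).2 ⟨x, Or.inl rfl⟩
    · exact ⟨y, h⟩
    · exfalso
      rw [hw] at h
      have h1 := (List.append_inj' h rfl).1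
      have h2 := congrArg List.length (g.1.injective h1)
      simp at h2

theorem length_apply (g : TreeAut m) (v : List (Fin m)) : (g.1 v).length = v.length :=
  (exists_child g v).1

/-- The level stabilizer `St(n)`: the automorphisms fixing all vertices of level `n`. -/
def levelStabilizer (m n : ℕ) : Subgroup (TreeAut m) where
  carrier := {g | ∀ v : List (Fin m), v.length = n → g.1 v = v}
  one_mem' := by simp
  mul_mem' := by
    intro g h hg hh v hv
    simp [hh v hv, hg v hv]
  inv_mem' := by
    intro g hg v hv
    change (g.1)⁻¹ v = v
    rw [Equiv.Perm.inv_eq_iff_eq, hg v hv]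

theorem mem_levelStabilizer {n : ℕ} {g : TreeAut m} :
    g ∈ levelStabilizer m n ↔ ∀ v : List (Fin m), v.length = n → g.1 v = v := Iff.rfl

theorem levelStabilizer_zero : levelStabilizer m 0 = ⊤ := by
  refine eq_top_iff.2 fun g _ v hv => ?_
  rw [List.length_eq_zero_iff.1 hv, g.2.1]

theorem levelStabilizer_antitone : Antitone (levelStabilizer m) := by
  refine antitone_nat_of_succ_le fun n g hg v hv => ?_
  rcases m with _ | m
  · have : v = [] := by
      cases v with
      | nil => rfl
      | cons a _ => exact a.elim0
    rw [this, g.2.1]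
  · obtain ⟨y, hy⟩ := (exists_child g v).2 0
    rw [hg (v ++ [0]) (by simp [hv])] at hy
    exact (List.append_inj' hy rfl).1.symm

theorem levelStabilizer_normal (n : ℕ) : (levelStabilizer m n).Normal := by
  refine ⟨fun g hg h v hv => ?_⟩
  change h.1 (g.1 ((h⁻¹).1 v)) = v
  rw [hg _ (by rw [length_apply, hv])]
  change h.1 ((h.1)⁻¹ v) = v
  simp

theorem iInf_levelStabilizer : ⨅ n, levelStabilizer m n = ⊥ := by
  refine (Subgroup.eq_bot_iff_forall _).2 fun g hg => ?_
  rw [Subgroup.mem_iInf] at hg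
  exact Subtype.ext (Equiv.ext fun v => hg v.length v rfl)

theorem levelStabilizer_finiteIndex (n : ℕ) : (levelStabilizer m n).FiniteIndex := by
  let f : TreeAut m → (List.Vector (Fin m) n → List.Vector (Fin m) n) :=
    fun g v => ⟨g.1 v.1, by rw [length_apply, v.2]⟩
  have key : ∀ g h : TreeAut m, f g = f h → g⁻¹ * h ∈ levelStabilizer m n := by
    intro g h hgh v hv
    have h1 : g.1 v = h.1 v := congrArg Subtype.val (congrFun hgh ⟨v, hv⟩)
    change (g.1)⁻¹ (h.1 v) = v
    rw [← h1]; simp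
  have : Finite (TreeAut m ⧸ levelStabilizer m n) := by
    refine Finite.of_injective (fun q => f q.out) fun a b hab => ?_
    rw [← Quotient.out_eq' a, ← Quotient.out_eq' b]
    exact QuotientGroup.eq.2 (key _ _ hab)
  exact Subgroup.finiteIndex_of_finite_quotient

/-- The level-stabilizer filtration of a group `G` of tree automorphisms, with terms
`St_G(n) = St(n) ∩ G`. -/
def levelFiltration (G : Subgroup (TreeAut m)) : GroupFiltration G where
  term n := (levelStabilizer m n).subgroupOf G
  term_zero := by rw [levelStabilizer_zero, Subgroup.top_subgroupOf]
  antitone _ _ h := Subgroup.comap_mono (levelStabilizer_antitone h)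
  normal n := by
    have := levelStabilizer_normal (m := m) n
    infer_instance
  finiteIndex n := by
    have := levelStabilizer_finiteIndex (m := m) n
    infer_instance
  iInf_eq_bot := by
    refine (Subgroup.eq_bot_iff_forall _).2 fun g hg => ?_
    have h : (g : TreeAut m) ∈ ⨅ n, levelStabilizer m n := by
      simp only [Subgroup.mem_iInf, Subgroup.mem_subgroupOf] at hg ⊢
      exact hg
    rw [iInf_levelStabilizer, Subgroup.mem_bot] at h
    exact Subtype.ext h

end TreeAut

/-- The iterated permutational wreath product `W_H`: the automorphisms all of whose labels lie in `H`.
The label of `g` at `v` is the unique permutation `σ` of `Fin m` with `g (v x) = g(v) σ(x)`. -/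
def iteratedWreathProduct {m : ℕ} (H : Subgroup (Equiv.Perm (Fin m))) : Subgroup (TreeAut m) where
  carrier := {g | ∀ v : List (Fin m), ∃ σ ∈ H, ∀ x, g.1 (v ++ [x]) = g.1 v ++ [σ x]}
  one_mem' v := ⟨1, H.one_mem, by simp⟩
  mul_mem' := by
    intro g h hg hh v
    obtain ⟨τ, hτ, hτ'⟩ := hh v
    obtain ⟨σ, hσ, hσ'⟩ := hg (h.1 v)
    exact ⟨σ * τ, H.mul_mem hσ hτ, fun x => by simp [hτ', hσ']⟩
  inv_mem' := by
    intro g hg v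
    obtain ⟨σ, hσ, hσ'⟩ := hg ((g.1)⁻¹ v)
    refine ⟨σ⁻¹, H.inv_mem hσ, fun x => ?_⟩
    change (g.1)⁻¹ (v ++ [x]) = (g.1)⁻¹ v ++ [σ⁻¹ x]
    rw [Equiv.Perm.inv_eq_iff_eq, hσ']
    simp

/-!
Let `U` be the set of words whose `m`-adic interval lies in `[0, a]`. It is closed under extension,
and a subgroup all of whose nontrivial labels lie in `U` has dimension at most `a`, because `U`
contains at most `a m ^ n` words of length `n`. For the converse bound we need a finitely generated
subgroup whose labels can be prescribed independently at all but few of the words of `U`; the Haar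
measure of its closure is then a mass distribution of dimension at least `b`, for every `b < a`.

Two kinds of generators are odometers, copied below each minimal word of `U` and below each of the
sites chosen beneath these words; since `H` is transitive, they move a word to any other word of the
same length. The other generators have constant labels on two sparse families, the sites and the
deep sites. These words are translates of words `z … z` by powers of an odometer, whose exponents
have base-`r` digits such that, after conjugation by the right power of the odometer, exactly one
deep site lies below a site. The commutator of the two generators then only sees this pair, and has
a single prescribed label, up to its inverse at one partner word of the same length. The partner
depends on about half of the letters of the word, so on each level there are too few partners to
matter.
-/

theorem relIndex_inf_eq_relIndex_subgroupOf {G : Type*} [Group G] (N M K : Subgroup G) :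
    N.relIndex (M ⊓ K) = (N.subgroupOf M).relIndex (K.subgroupOf M) := by
  rw [← Subgroup.relIndex_subgroupOf inf_le_left, inf_comm, Subgroup.inf_subgroupOf_right]

theorem exists_smul_ne (G α : Type*) [SMul G α] [MulAction.IsPretransitive G α] [Nontrivial α] :
    ∃ (x : α) (g : G), g • x ≠ x := by
  obtain ⟨x, y, hne⟩ := exists_pair_ne α
  obtain ⟨g, rfl⟩ := MulAction.exists_smul_eq G x y
  exact ⟨x, g, hne.symm⟩

section Commutator

open scoped commutatorElement

theorem commutatorElement_mul_mul_of_commute {G : Type*} [Group G] {x₁ x₀ f₁ f₀ : G}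
    (h₀₁ : Commute x₀ f₁) (h₀₀ : Commute x₀ f₀) (h₁₀ : Commute x₁ f₀) :
    ⁅x₁ * x₀, f₁ * f₀⁆ = ⁅x₁, f₁⁆ := by
  have h : Commute x₀ (f₁ * f₀) := h₀₁.mul_right h₀₀
  simp only [commutatorElement_def, mul_inv_rev]
  calc x₁ * x₀ * (f₁ * f₀) * (x₀⁻¹ * x₁⁻¹) * (f₀⁻¹ * f₁⁻¹)
      = x₁ * (x₀ * (f₁ * f₀)) * x₀⁻¹ * x₁⁻¹ * f₀⁻¹ * f₁⁻¹ := by group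
    _ = x₁ * f₁ * (f₀ * x₁⁻¹) * f₀⁻¹ * f₁⁻¹ := by rw [h.eq]; group
    _ = x₁ * f₁ * x₁⁻¹ * f₁⁻¹ := by rw [← h₁₀.inv_left.eq]; group

end Commutator

section MassDistribution

open MeasureTheory

theorem le_dimH_of_forall_measure_le {X : Type*} [EMetricSpace X] [MeasurableSpace X]
    [BorelSpace X] {μ : Measure X} {S : Set X} (hS : μ S ≠ 0) {a C : NNReal}
    (hμ : ∀ s, μ s ≤ C * Metric.ediam s ^ (a : ℝ)) : (a : ℝ≥0∞) ≤ dimH S := by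
  have hle : (C : ℝ≥0∞)⁻¹ • μ ≤ Measure.hausdorffMeasure (a : ℝ) :=
    Measure.le_hausdorffMeasure _ _ 1 one_pos fun s _ => by
      rw [Measure.smul_apply, smul_eq_mul, mul_comm, ← div_eq_mul_inv]
      exact ENNReal.div_le_of_le_mul' (hμ s)
  refine le_dimH_of_hausdorffMeasure_ne_zero fun h => ?_
  have hS' := hle S
  simp [h, hS] at hS'

theorem exists_measure_coset_le {G : Type*} [Group G] [TopologicalSpace G]
    [IsTopologicalGroup G] [CompactSpace G] [MeasurableSpace G] [BorelSpace G] {K : Subgroup G}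
    (hK : IsClosed (K : Set G)) :
    ∃ μ : Measure G, μ (K : Set G) = 1 ∧ ∀ N : Subgroup G, MeasurableSet (N : Set G) →
      ∀ x, μ {y | x⁻¹ * y ∈ N} ≤ (N.relIndex K : ℝ≥0∞)⁻¹ := by
  have : CompactSpace K := isCompact_iff_compactSpace.1 hK.isCompact
  let ν : Measure K := Measure.haarMeasure ⊤
  have hval : Measurable (Subtype.val : K → G) := continuous_subtype_val.measurable
  refine ⟨ν.map Subtype.val, ?_, fun N hN x => ?_⟩
  · rw [Measure.map_apply hval hK.measurableSet, Subtype.coe_preimage_self]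
    exact Measure.haarMeasure_self
  rcases eq_or_ne (N.relIndex K) 0 with h0 | h0
  · simp [h0]
  have : (N.subgroupOf K).FiniteIndex := ⟨h0⟩
  have hsubgroup : ν (N.subgroupOf K) ≤ (N.relIndex K : ℝ≥0∞)⁻¹ := by
    rw [ENNReal.le_inv_iff_mul_le, mul_comm]
    exact ((N.subgroupOf K).index_mul_measure (hval hN) ν).trans_le
      (Measure.haarMeasure_self (G := K)).le
  rw [Measure.map_apply hval (show MeasurableSet {y | x⁻¹ * y ∈ N} from
    measurable_const_mul x⁻¹ hN)]
  rcases (Subtype.val ⁻¹' {y | x⁻¹ * y ∈ N} : Set K).eq_empty_or_nonempty with hempty | ⟨k, hk⟩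
  · simp [hempty]
  · refine (measure_mono fun y hy => ?_).trans
      ((measure_preimage_mul ν k⁻¹ (N.subgroupOf K : Set K)).trans_le hsubgroup)
    simpa [mul_assoc, Subgroup.mem_subgroupOf] using
      mul_mem (inv_mem hk) (show x⁻¹ * (y : G) ∈ N from hy)

end MassDistribution

namespace GroupFiltration

open Filter Topology MeasureTheory

variable {G : Type*} [Group G] (F : GroupFiltration G)

theorem isOpen_coset_term (n : ℕ) (x : G) : @IsOpen G F.topology {y | x⁻¹ * y ∈ F.term n} :=
  fun y hy => ⟨n, fun k hk => by
    simpa [mul_assoc] using mul_mem (show x⁻¹ * y ∈ F.term n from hy) hk⟩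

theorem mem_nhds_topology_iff {g : G} {U : Set G} :
    U ∈ @nhds G F.topology g ↔ ∃ n, ∀ k ∈ F.term n, g * k ∈ U := by
  let := F.topology
  rw [mem_nhds_iff]
  constructor
  · rintro ⟨V, hVU, hV, hg⟩
    obtain ⟨n, hn⟩ := hV g hg
    exact ⟨n, fun k hk => hVU (hn k hk)⟩
  · rintro ⟨n, hn⟩
    exact ⟨{x | g⁻¹ * x ∈ F.term n}, fun x hx => by simpa using hn _ hx,
      F.isOpen_coset_term n g, by simp⟩

theorem isTopologicalGroup_topology : @IsTopologicalGroup G F.topology _ := by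
  let := F.topology
  have normal := F.normal
  refine { continuous_mul := ?_, continuous_inv := ?_ }
  · refine continuous_iff_continuousAt.2 fun p U hU => ?_
    obtain ⟨n, hU⟩ := F.mem_nhds_topology_iff.1 hU
    rw [mem_map, nhds_prod_eq, mem_prod_iff]
    refine ⟨_, (F.isOpen_coset_term n p.1).mem_nhds (by simp), _,
      (F.isOpen_coset_term n p.2).mem_nhds (by simp), ?_⟩
    rintro ⟨x, y⟩ ⟨hx, hy⟩
    simpa [mul_assoc] using hU _ (mul_mem ((normal n).conj_mem _ hx p.2⁻¹) hy)
  · refine continuous_iff_continuousAt.2 fun p U hU => ?_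
    obtain ⟨n, hU⟩ := F.mem_nhds_topology_iff.1 hU
    refine F.mem_nhds_topology_iff.2 ⟨n, fun k hk => ?_⟩
    simpa [mul_assoc] using hU _ ((normal n).conj_mem _ (inv_mem hk) p)

theorem exists_inv_mul_mem_term_of_mem_closure {S : Set G} {g : G}
    (h : g ∈ @closure G F.topology S) (n : ℕ) : ∃ s ∈ S, g⁻¹ * s ∈ F.term n := by
  let := F.topology
  obtain ⟨s, hs, hsS⟩ :=
    mem_closure_iff_nhds.1 h _ ((F.isOpen_coset_term n g).mem_nhds (by simp))
  exact ⟨s, hsS, hs⟩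

/-- The topological closure of a subgroup for the topology of the filtration. -/
def closedSubgroup (K : Subgroup G) : Subgroup G :=
  @Subgroup.topologicalClosure G F.topology _ F.isTopologicalGroup_topology K

theorem isClosedSubgroup_closedSubgroup (K : Subgroup G) :
    F.IsClosedSubgroup (F.closedSubgroup K) :=
  @isClosed_closure G F.topology _

theorem le_closedSubgroup (K : Subgroup G) : K ≤ F.closedSubgroup K :=
  @Subgroup.le_topologicalClosure G F.topology _ F.isTopologicalGroup_topology K

theorem mul_inv_mem_term_iff {n : ℕ} {x y : G} : x * y⁻¹ ∈ F.term n ↔ x⁻¹ * y ∈ F.term n := by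
  have normal := F.normal n
  rw [normal.mem_comm_iff, ← inv_mem_iff]; simp

theorem distance_le_inv_index {n : ℕ} {x y : G} (h : x⁻¹ * y ∈ F.term n) :
    F.distance x y ≤ ((F.term n).index : ℝ≥0∞)⁻¹ := by
  unfold distance
  split_ifs
  · exact zero_le
  · exact iInf₂_le n (F.mul_inv_mem_term_iff.2 h)

theorem inv_mul_mem_term_succ_of_distance_lt {n : ℕ} {x y : G}
    (h : F.distance x y < ((F.term n).index : ℝ≥0∞)⁻¹) : x⁻¹ * y ∈ F.term (n + 1) := by
  unfold distance at h
  split_ifs at h with hxy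
  · simp [hxy]
  · obtain ⟨i, hi⟩ := iInf_lt_iff.1 h
    obtain ⟨hxi, hi⟩ := iInf_lt_iff.1 hi
    rw [ENNReal.inv_lt_inv, Nat.cast_lt] at hi
    refine F.mul_inv_mem_term_iff.1 (F.antitone ?_ hxi)
    by_contra hlt
    have := F.finiteIndex n
    exact absurd (Subgroup.index_antitone (F.antitone (show i ≤ n by omega))) (by omega)

theorem tendsto_inv_index (hF : Tendsto (fun n => (F.term n).index) atTop atTop) :
    Tendsto (fun n => ((F.term n).index : ℝ≥0∞)⁻¹) atTop (𝓝 0) :=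
  ENNReal.tendsto_inv_nat_nhds_zero.comp hF

theorem topology_metric_eq (hF : Tendsto (fun n => (F.term n).index) atTop atTop) :
    F.metric.toPseudoEMetricSpace.toUniformSpace.toTopologicalSpace = F.topology := by
  refine TopologicalSpace.ext_nhds fun g => Filter.ext fun U => ?_
  rw [F.mem_nhds_topology_iff]
  let := F.metric
  rw [EMetric.mem_nhds_iff]
  constructor
  · rintro ⟨ε, hε, hU⟩
    obtain ⟨n, hn⟩ := ((F.tendsto_inv_index hF).eventually (gt_mem_nhds hε)).exists
    refine ⟨n, fun k hk => hU ?_⟩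
    rw [Metric.mem_eball, edist_comm]
    exact (F.distance_le_inv_index (by simpa using hk)).trans_lt hn
  · rintro ⟨n, hn⟩
    refine ⟨((F.term n).index : ℝ≥0∞)⁻¹, ENNReal.inv_pos.2 (ENNReal.natCast_ne_top _), ?_⟩
    intro x hx
    rw [Metric.mem_eball, edist_comm] at hx
    have := hn _ (F.antitone n.le_succ (F.inv_mul_mem_term_succ_of_distance_lt hx))
    simpa using this

theorem hdim_le (hF : Tendsto (fun n => (F.term n).index) atTop atTop) {K : Subgroup G}
    {a : NNReal} (h : ∃ᶠ n in atTop,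
      ((F.term n).relIndex K : ℝ≥0∞) ≤ ((F.term n).index : ℝ≥0∞) ^ (a : ℝ)) :
    F.hdim K ≤ a := by
  let := F.metric
  let : MeasurableSpace G := borel G
  have : BorelSpace G := ⟨rfl⟩
  have := fun n => (F.finiteIndex n)
  let (n : ℕ) : Fintype (K ⧸ (F.term n).subgroupOf K) := Fintype.ofFinite _
  let coset (n : ℕ) (q : K ⧸ (F.term n).subgroupOf K) : Set G :=
    Subtype.val '' {k : K | (k : K ⧸ (F.term n).subgroupOf K) = q}
  have ediam_coset_le (n : ℕ) (q : K ⧸ (F.term n).subgroupOf K) :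
      Metric.ediam (coset n q) ≤ ((F.term n).index : ℝ≥0∞)⁻¹ := by
    refine Metric.ediam_le ?_
    rintro _ ⟨x, hx, rfl⟩ _ ⟨y, hy, rfl⟩
    have hxy : (x : K ⧸ (F.term n).subgroupOf K) = y := hx.trans hy.symm
    have hmem : x⁻¹ * y ∈ (F.term n).subgroupOf K := QuotientGroup.eq.1 hxy
    exact F.distance_le_inv_index hmem
  have subset_iUnion_coset (n : ℕ) : (K : Set G) ⊆ ⋃ q, coset n q := fun x hx =>
    Set.mem_iUnion.2 ⟨(⟨x, hx⟩ : K), ⟨x, hx⟩, rfl, rfl⟩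
  have measure_le_one : Measure.hausdorffMeasure (a : ℝ) (K : Set G) ≤ 1 := by
    refine (Measure.hausdorffMeasure_le_liminf_sum (a : ℝ) (K : Set G) _ (F.tendsto_inv_index hF)
      coset (Eventually.of_forall ediam_coset_le) (Eventually.of_forall subset_iUnion_coset)).trans
      (liminf_le_of_frequently_le' (h.mono fun n hn => ?_))
    refine (Finset.sum_le_sum fun q _ =>
      ENNReal.rpow_le_rpow (ediam_coset_le n q) a.2).trans ?_
    rw [Finset.sum_const, Finset.card_univ, ← Nat.card_eq_fintype_card, nsmul_eq_mul,
      ENNReal.inv_rpow, ← div_eq_mul_inv]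
    exact ENNReal.div_le_of_le_mul (by simpa [Subgroup.relIndex, Subgroup.index] using hn)
  exact dimH_le_of_hausdorffMeasure_ne_top (ne_top_of_le_ne_top ENNReal.one_ne_top measure_le_one)

theorem hdim_le_one (hF : Tendsto (fun n => (F.term n).index) atTop atTop) (K : Subgroup G) :
    F.hdim K ≤ 1 := by
  refine F.hdim_le (a := 1) hF (Eventually.of_forall fun n => ?_).frequently
  have := F.finiteIndex n
  simpa using Subgroup.relIndex_le_of_le_right (H := F.term n) (le_top : K ≤ ⊤)
    (by simpa using this.index_ne_zero)

theorem exists_subset_coset_of_ediam_pos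
    (hF : Tendsto (fun n => (F.term n).index) atTop atTop) {s : Set G} {x : G} (hx : x ∈ s)
    (hs : 0 < @Metric.ediam G F.metric.toPseudoEMetricSpace s) :
    ∃ n, s ⊆ {y | x⁻¹ * y ∈ F.term n} ∧
      ((F.term n).index : ℝ≥0∞)⁻¹ ≤ @Metric.ediam G F.metric.toPseudoEMetricSpace s := by
  classical
  let := F.metric
  have hex : ∃ n, ((F.term n).index : ℝ≥0∞)⁻¹ ≤ Metric.ediam s :=
    ((F.tendsto_inv_index hF).eventually (gt_mem_nhds hs)).exists.imp fun _ => le_of_lt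
  refine ⟨Nat.find hex, fun y hy => ?_, Nat.find_spec hex⟩
  rcases hn : Nat.find hex with _ | n
  · simp [F.term_zero]
  · exact F.inv_mul_mem_term_succ_of_distance_lt ((Metric.edist_le_ediam_of_mem hx hy).trans_lt
      (not_le.1 (Nat.find_min hex (hn ▸ n.lt_succ_self))))

theorem le_hdim (hF : Tendsto (fun n => (F.term n).index) atTop atTop)
    (hG : @CompactSpace G F.topology) {K : Subgroup G} (hK : F.IsClosedSubgroup K) {a C : NNReal}
    (h : ∀ n, ((F.term n).index : ℝ≥0∞) ^ (a : ℝ) ≤ C * (F.term n).relIndex K) :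
    a ≤ F.hdim K := by
  rcases eq_or_ne a 0 with rfl | ha
  · simp
  have htop := F.topology_metric_eq hF
  have isTopologicalGroup := F.isTopologicalGroup_topology
  have isOpen_term (n : ℕ) : @IsOpen G F.topology (F.term n) := by
    simpa using! F.isOpen_coset_term n 1
  unfold IsClosedSubgroup at hK
  rw [← htop] at hG hK isTopologicalGroup isOpen_term
  let := F.metric
  let : MeasurableSpace G := borel G
  have : BorelSpace G := ⟨rfl⟩
  obtain ⟨μ, hμK, hμ⟩ := exists_measure_coset_le hK
  have measure_coset_le (n : ℕ) (x : G) :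
      μ {y | x⁻¹ * y ∈ F.term n} ≤ C * (((F.term n).index : ℝ≥0∞)⁻¹) ^ (a : ℝ) := by
    refine (hμ _ (isOpen_term n).measurableSet x).trans ?_
    have := F.finiteIndex n
    have hindex : ((F.term n).index : ℝ≥0∞) ≠ 0 := by simpa using this.index_ne_zero
    have hpow : ((F.term n).index : ℝ≥0∞) ^ (a : ℝ) ≠ ⊤ := by simp
    rw [ENNReal.inv_rpow, ← div_eq_mul_inv, ENNReal.le_div_iff_mul_le (by simp [hindex])
      (Or.inl hpow), mul_comm, ← div_eq_mul_inv]
    exact ENNReal.div_le_of_le_mul (h n)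
  refine le_dimH_of_forall_measure_le (μ := μ) (C := C) (by simp [hμK]) fun s => ?_
  rcases s.eq_empty_or_nonempty with rfl | ⟨x, hx⟩
  · simp
  rcases (zero_le (a := Metric.ediam s)).eq_or_lt with hs | hs
  · have hsub (n : ℕ) : s ⊆ {y | x⁻¹ * y ∈ F.term n} := fun y hy => by
      simp [Metric.ediam_eq_zero_iff.1 hs.symm hy hx]
    refine ge_of_tendsto' (x := atTop) ?_ fun n => (measure_mono (hsub n)).trans
      (measure_coset_le n x)
    rw [← hs]
    exact ENNReal.Tendsto.const_mul ((F.tendsto_inv_index hF).ennrpow_const _) (by simp)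
  · obtain ⟨n, hsub, hn⟩ := F.exists_subset_coset_of_ediam_pos hF hx hs
    calc μ s ≤ C * (((F.term n).index : ℝ≥0∞)⁻¹) ^ (a : ℝ) :=
          (measure_mono hsub).trans (measure_coset_le n x)
      _ ≤ C * Metric.ediam s ^ (a : ℝ) := by gcongr

theorem relIndex_term_succ (K : Subgroup G) (n : ℕ) :
    (F.term n).relIndex K * (F.term (n + 1)).relIndex (F.term n ⊓ K) =
      (F.term (n + 1)).relIndex K := by
  rw [mul_comm, Subgroup.relIndex_inf_mul_relIndex, inf_eq_left.2 (F.antitone n.le_succ)]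

theorem hspecBounded_subset_hspecFG (b : ℕ) : F.hspecBounded b ⊆ F.hspecFG :=
  fun _ ⟨K, hK, ⟨S, _, hS⟩, hd⟩ => ⟨K, hK, ⟨S, hS⟩, hd⟩

theorem hspecFG_subset_hspec : F.hspecFG ⊆ F.hspec :=
  fun _ ⟨K, hK, _, hd⟩ => ⟨K, hK, hd⟩

end GroupFiltration

namespace iteratedWreathProduct

variable {m : ℕ} {H : Subgroup (Equiv.Perm (Fin m))}

/-- The level-stabilizer filtration of the iterated wreath product. -/
noncomputable abbrev filtration (H : Subgroup (Equiv.Perm (Fin m))) :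
    GroupFiltration (iteratedWreathProduct H) :=
  TreeAut.levelFiltration (iteratedWreathProduct H)

/-- The label of `g` at the vertex `v`. -/
noncomputable def label (g : iteratedWreathProduct H) (v : List (Fin m)) : H :=
  ⟨Classical.choose (g.2 v), (Classical.choose_spec (g.2 v)).1⟩

theorem smul_concat (g : iteratedWreathProduct H) (v : List (Fin m)) (x : Fin m) :
    g • (v ++ [x]) = g • v ++ [(label g v).1 x] :=
  (Classical.choose_spec (g.2 v)).2 x

theorem length_smul (g : iteratedWreathProduct H) (v : List (Fin m)) :
    (g • v).length = v.length :=
  TreeAut.length_apply g.1 v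

theorem smul_nil (g : iteratedWreathProduct H) : g • ([] : List (Fin m)) = [] :=
  List.length_eq_zero_iff.1 (length_smul g [])

theorem label_eq_of_forall {g : iteratedWreathProduct H} {v : List (Fin m)} {σ : H}
    (h : ∀ x, g • (v ++ [x]) = g • v ++ [σ.1 x]) : label g v = σ := by
  refine Subtype.ext (Equiv.ext fun x => ?_)
  simpa using (smul_concat g v x).symm.trans (h x)

theorem label_mul (g k : iteratedWreathProduct H) (v : List (Fin m)) :
    label (g * k) v = label g (k • v) * label k v :=
  label_eq_of_forall fun x => by simp [mul_smul, smul_concat]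

theorem label_one (v : List (Fin m)) : label (1 : iteratedWreathProduct H) v = 1 :=
  label_eq_of_forall fun x => by simp

theorem label_inv_smul (g : iteratedWreathProduct H) (v : List (Fin m)) :
    label g⁻¹ (g • v) = (label g v)⁻¹ := by
  rw [eq_inv_iff_mul_eq_one, ← label_mul, inv_mul_cancel, label_one]

theorem take_smul (g : iteratedWreathProduct H) (v : List (Fin m)) (n : ℕ) :
    (g • v).take n = g • v.take n := by
  induction v using List.reverseRecOn with
  | nil => simp [smul_nil]
  | append_singleton v x ih =>
    rcases le_or_gt n v.length with h | h
    · rw [smul_concat, List.take_append_of_le_length (by rwa [length_smul]),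
        List.take_append_of_le_length h, ih]
    · rw [List.take_of_length_le (l := v ++ [x]) (by simpa using h),
        List.take_of_length_le (by rw [length_smul]; simpa using h)]

theorem smul_prefix_smul_iff (g : iteratedWreathProduct H) {u v : List (Fin m)} :
    g • u <+: g • v ↔ u <+: v := by
  rw [List.prefix_iff_eq_take, List.prefix_iff_eq_take, length_smul, take_smul,
    smul_left_cancel_iff]

theorem exists_smul_append_eq (g : iteratedWreathProduct H) (u v : List (Fin m)) :
    ∃ v', v'.length = v.length ∧ g • (u ++ v) = g • u ++ v' := by
  obtain ⟨t, ht⟩ := (smul_prefix_smul_iff g).2 (List.prefix_append u v)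
  refine ⟨t, ?_, ht.symm⟩
  simpa [length_smul] using congrArg List.length ht

theorem smul_eq_smul_of_label_eq {g k : iteratedWreathProduct H} {w : List (Fin m)}
    (h : ∀ v, v <+: w → v ≠ w → label g v = label k v) : g • w = k • w := by
  induction w using List.reverseRecOn with
  | nil => simp [smul_nil]
  | append_singleton w x ih =>
    have hw : w <+: w ++ [x] := List.prefix_append w [x]
    rw [smul_concat, smul_concat, h w hw (by simp), ih fun v hv hne => h v (hv.trans hw) ?_]
    rintro rfl
    exact hne (hw.eq_of_length_le hv.length_le).symm

theorem ext_label {g k : iteratedWreathProduct H} (h : ∀ v, label g v = label k v) : g = k :=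
  Subtype.ext (Subtype.ext (Equiv.ext fun _ => smul_eq_smul_of_label_eq fun v _ _ => h v))

theorem mem_term_iff_smul {n : ℕ} {g : iteratedWreathProduct H} :
    g ∈ (filtration H).term n ↔ ∀ v : List (Fin m), v.length = n → g • v = v := Iff.rfl

theorem smul_eq_of_mem_term {n : ℕ} {g : iteratedWreathProduct H}
    (hg : g ∈ (filtration H).term n) {v : List (Fin m)} (hv : v.length ≤ n) : g • v = v :=
  mem_term_iff_smul.1 ((filtration H).antitone hv hg) v rfl

theorem mem_term_iff {n : ℕ} {g : iteratedWreathProduct H} :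
    g ∈ (filtration H).term n ↔ ∀ v : List (Fin m), v.length < n → label g v = 1 := by
  constructor
  · refine fun hg v hv => label_eq_of_forall fun x => ?_
    rw [smul_eq_of_mem_term hg hv.le, smul_eq_of_mem_term hg (by simpa using hv)]; simp
  · rintro h w rfl
    change g • w = w
    rw [smul_eq_smul_of_label_eq (k := 1) fun v hv hne => ?_, one_smul]
    rw [label_one, h v (hv.length_le.lt_of_ne fun hl => hne (hv.eq_of_length hl))]

theorem inv_mul_mem_term_iff {n : ℕ} {g k : iteratedWreathProduct H} :
    g⁻¹ * k ∈ (filtration H).term n ↔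
      ∀ v : List (Fin m), v.length < n → label g v = label k v := by
  constructor
  · intro h v hv
    rw [← mul_inv_cancel_left g k, label_mul, smul_eq_of_mem_term h hv.le,
      mem_term_iff.1 h v hv, mul_one]
  · rintro h w rfl
    change (g⁻¹ * k) • w = w
    rw [mul_smul, ← smul_eq_smul_of_label_eq (g := g) fun v hv hne => h v ?_, inv_smul_smul]
    exact hv.length_le.lt_of_ne fun hl => hne (hv.eq_of_length hl)

/-- The action on words with label `l v` at each vertex `v`. -/
def portraitAct (l : List (Fin m) → H) : List (Fin m) → List (Fin m)
  | [] => []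
  | x :: w => (l []).1 x :: portraitAct (fun u => l (x :: u)) w

/-- The inverse of `portraitAct l`. -/
def portraitInvAct (l : List (Fin m) → H) : List (Fin m) → List (Fin m)
  | [] => []
  | y :: w => (l [])⁻¹.1 y :: portraitInvAct (fun u => l ((l [])⁻¹.1 y :: u)) w

theorem portraitInvAct_portraitAct (l : List (Fin m) → H) (w : List (Fin m)) :
    portraitInvAct l (portraitAct l w) = w := by
  induction w generalizing l with
  | nil => rfl
  | cons x w ih => simp [portraitAct, portraitInvAct, ih]

theorem portraitAct_portraitInvAct (l : List (Fin m) → H) (w : List (Fin m)) :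
    portraitAct l (portraitInvAct l w) = w := by
  induction w generalizing l with
  | nil => rfl
  | cons x w ih => simp [portraitAct, portraitInvAct, ih]

theorem portraitAct_concat (l : List (Fin m) → H) (v : List (Fin m)) (x : Fin m) :
    portraitAct l (v ++ [x]) = portraitAct l v ++ [(l v).1 x] := by
  induction v generalizing l with
  | nil => rfl
  | cons y v ih => simp [portraitAct, ih]

theorem exists_portraitAct_eq_concat_iff (l : List (Fin m) → H) (u v : List (Fin m)) :
    (∃ x, portraitAct l u = portraitAct l v ++ [x]) ↔ ∃ x, u = v ++ [x] := by
  constructor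
  · rintro ⟨x, hx⟩
    refine ⟨(l v)⁻¹.1 x, Function.LeftInverse.injective (portraitInvAct_portraitAct l) ?_⟩
    simp [hx, portraitAct_concat]
  · rintro ⟨x, rfl⟩
    exact ⟨_, portraitAct_concat l v x⟩

/-- The element of the iterated wreath product with given labels. -/
def ofPortrait (l : List (Fin m) → H) : iteratedWreathProduct H where
  val := ⟨⟨portraitAct l, portraitInvAct l, portraitInvAct_portraitAct l,
      portraitAct_portraitInvAct l⟩, rfl, fun u v => by
    simp only [adicTree, Equiv.coe_fn_mk, exists_or, exists_portraitAct_eq_concat_iff]⟩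
  property v := ⟨(l v).1, (l v).2, portraitAct_concat l v⟩

theorem ofPortrait_smul_cons (l : List (Fin m) → H) (x : Fin m) (w : List (Fin m)) :
    ofPortrait l • (x :: w) = (l []).1 x :: ofPortrait (fun u => l (x :: u)) • w := rfl

@[simp]
theorem label_ofPortrait (l : List (Fin m) → H) (v : List (Fin m)) :
    label (ofPortrait l) v = l v :=
  label_eq_of_forall fun x => portraitAct_concat l v x

theorem compactSpace : @CompactSpace _ (filtration H).topology := by
  let := (filtration H).topology
  let : TopologicalSpace H := ⊥
  have : DiscreteTopology H := ⟨rfl⟩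
  have continuous_ofPortrait : Continuous (ofPortrait (H := H)) := by
    refine continuous_iff_continuousAt.2 fun l U hU => ?_
    obtain ⟨n, hn⟩ := (filtration H).mem_nhds_topology_iff.1 hU
    have agree_below : ∀ᶠ l' in nhds l, ∀ w ∈ {w : List (Fin m) | w.length < n}, l' w = l w :=
      (Filter.eventually_all_finite (List.finite_length_lt (Fin m) n)).2 fun w _ =>
        (continuous_apply w).continuousAt.eventually
          (Filter.eventually_of_mem ((isOpen_discrete {l w}).mem_nhds rfl) fun _ h => h)
    refine Filter.mem_map.2 (Filter.mem_of_superset agree_below fun l' hl' => ?_)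
    simpa using hn ((ofPortrait l)⁻¹ * ofPortrait l') (inv_mul_mem_term_iff.2 fun v hv => by
      simpa using (hl' v hv).symm)
  have surjective_ofPortrait : Function.Surjective (ofPortrait (H := H)) := fun g =>
    ⟨label g, ext_label fun v => by simp⟩
  exact ⟨surjective_ofPortrait.range_eq ▸ isCompact_range continuous_ofPortrait⟩

/-- The words of length `n` in `U`. -/
def levelSet (U : Set (List (Fin m))) (n : ℕ) : Set (List (Fin m)) := {w | w ∈ U ∧ w.length = n}

instance (U : Set (List (Fin m))) (n : ℕ) : Finite (levelSet U n) :=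
  ((List.finite_length_eq (Fin m) n).subset fun _ h => h.2).to_subtype

theorem ncard_levelSet_univ (n : ℕ) :
    (levelSet (Set.univ : Set (List (Fin m))) n).ncard = m ^ n := by
  have h : levelSet (Set.univ : Set (List (Fin m))) n = {w | w.length = n} := by
    simp [levelSet]
  rw [h, ← Nat.card_coe_set_eq]
  exact (Nat.card_eq_fintype_card (α := List.Vector (Fin m) n)).trans (by simp [card_vector])

/-- The labels at the words of length `n` in `U`, as a homomorphism on the stabilizer of level
`n`. -/
noncomputable def levelLabel (U : Set (List (Fin m))) (n : ℕ) :
    (filtration H).term n →* (levelSet U n → H) where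
  toFun g w := label g.1 w
  map_one' := funext fun w => label_one w.1
  map_mul' g k := funext fun w => by
    simp [label_mul, smul_eq_of_mem_term k.2 w.2.2.le]

theorem relIndex_inf_term_le {K : Subgroup (iteratedWreathProduct H)} {U : Set (List (Fin m))}
    (hK : ∀ g ∈ K, ∀ w ∉ U, label g w = 1) (n : ℕ) :
    ((filtration H).term (n + 1)).relIndex ((filtration H).term n ⊓ K) ≤
      Nat.card H ^ (levelSet U n).ncard := by
  have ker_inf_le : (levelLabel U n).ker ⊓ K.subgroupOf ((filtration H).term n) ≤
      ((filtration H).term (n + 1)).subgroupOf ((filtration H).term n) := by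
    rintro g ⟨hg, hgK⟩
    refine mem_term_iff.2 fun v hv => ?_
    rcases Nat.lt_succ_iff_lt_or_eq.1 hv with hv | hv
    · exact mem_term_iff.1 g.2 v hv
    by_cases hvU : v ∈ U
    · exact congrFun hg ⟨v, hvU, hv⟩
    · exact hK _ hgK v hvU
  have relIndex_ker_ne_zero : (levelLabel (H := H) U n).ker.relIndex
      (K.subgroupOf ((filtration H).term n)) ≠ 0 := by
    rw [Subgroup.relIndex_ker]; exact Nat.card_pos.ne'
  rw [relIndex_inf_eq_relIndex_subgroupOf]
  calc _ ≤ (levelLabel U n).ker.relIndex (K.subgroupOf ((filtration H).term n)) := by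
        refine (Subgroup.relIndex_le_of_le_left ker_inf_le ?_).trans_eq ?_
        · rwa [Subgroup.inf_relIndex_right]
        · rw [Subgroup.inf_relIndex_right]
    _ ≤ Nat.card (levelSet U n → H) := by
        rw [Subgroup.relIndex_ker]
        exact Nat.card_le_card_of_injective _ Subtype.val_injective
    _ = Nat.card H ^ (levelSet U n).ncard := Nat.card_fun

/-- On each level the labels of `K` at the words of `S` can be prescribed one at a time, by
elements of `K` fixing that level. -/
def HasIndependentLabels (K : Subgroup (iteratedWreathProduct H)) (S : Set (List (Fin m))) : Prop :=
  ∀ u ∈ S, ∀ h : H, ∃ s ∈ K, s ∈ (filtration H).term u.length ∧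
    ∀ w ∈ S, w.length = u.length → label s w = (Pi.mulSingle u h : List (Fin m) → H) w

theorem HasIndependentLabels.le_relIndex_inf_term {K : Subgroup (iteratedWreathProduct H)}
    {S : Set (List (Fin m))} (hS : HasIndependentLabels K S) (n : ℕ) :
    Nat.card H ^ (levelSet S n).ncard ≤
      ((filtration H).term (n + 1)).relIndex ((filtration H).term n ⊓ K) := by
  have map_levelLabel_eq_top :
      (K.subgroupOf ((filtration H).term n)).map (levelLabel S n) = ⊤ := by
    refine (Subgroup.eq_top_iff' _).2 fun f => Subgroup.pi_mem_of_mulSingle_mem f ?_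
    rintro ⟨u, hu, rfl⟩
    obtain ⟨s, hsK, hs, hlabel⟩ := hS u hu (f ⟨u, hu, rfl⟩)
    refine ⟨⟨s, hs⟩, hsK, funext fun w => (hlabel w.1 w.2.1 w.2.2).trans ?_⟩
    simp [Pi.mulSingle_apply, Subtype.ext_iff]
  have term_succ_le_ker : ((filtration H).term (n + 1)).subgroupOf ((filtration H).term n) ≤
      (levelLabel S n).ker := fun g hg =>
    funext fun w => mem_term_iff.1 hg w.1 (w.2.2.trans_lt n.lt_succ_self)
  have := (filtration H).finiteIndex (n + 1)
  rw [relIndex_inf_eq_relIndex_subgroupOf]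
  calc Nat.card H ^ (levelSet S n).ncard = Nat.card (levelSet S n → H) := Nat.card_fun.symm
    _ = (levelLabel S n).ker.relIndex (K.subgroupOf ((filtration H).term n)) := by
        rw [Subgroup.relIndex_ker, map_levelLabel_eq_top, Subgroup.card_top]
    _ ≤ _ := Subgroup.relIndex_le_of_le_left term_succ_le_ker
        Subgroup.FiniteIndex.index_ne_zero

theorem relIndex_le {K : Subgroup (iteratedWreathProduct H)} {U : Set (List (Fin m))}
    (hK : ∀ g ∈ K, ∀ w ∉ U, label g w = 1) (n : ℕ) :
    ((filtration H).term n).relIndex K ≤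
      Nat.card H ^ ∑ k ∈ Finset.range n, (levelSet U k).ncard := by
  induction n with
  | zero => simp [(filtration H).term_zero]
  | succ n ih =>
    rw [← (filtration H).relIndex_term_succ, Finset.sum_range_succ, pow_add]
    exact Nat.mul_le_mul ih (relIndex_inf_term_le hK n)

theorem HasIndependentLabels.le_relIndex {K : Subgroup (iteratedWreathProduct H)}
    {S : Set (List (Fin m))} (hS : HasIndependentLabels K S) (n : ℕ) :
    Nat.card H ^ ∑ k ∈ Finset.range n, (levelSet S k).ncard ≤
      ((filtration H).term n).relIndex K := by
  induction n with
  | zero => simp [(filtration H).term_zero]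
  | succ n ih =>
    rw [← (filtration H).relIndex_term_succ, Finset.sum_range_succ, pow_add]
    exact Nat.mul_le_mul ih (hS.le_relIndex_inf_term n)

theorem hasIndependentLabels_top (S : Set (List (Fin m))) :
    HasIndependentLabels (⊤ : Subgroup (iteratedWreathProduct H)) S := fun u _ h => by
  refine ⟨ofPortrait (Pi.mulSingle u h), Subgroup.mem_top _, mem_term_iff.2 fun v hv => ?_,
    fun w _ _ => label_ofPortrait _ w⟩
  rw [label_ofPortrait, Pi.mulSingle_eq_of_ne (by rintro rfl; exact hv.false)]

theorem index_term (n : ℕ) :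
    ((filtration H).term n).index = Nat.card H ^ ∑ k ∈ Finset.range n, m ^ k := by
  simp only [← Subgroup.relIndex_top_right, ← ncard_levelSet_univ (m := m)]
  exact le_antisymm (relIndex_le (by simp) n) ((hasIndependentLabels_top _).le_relIndex n)

open scoped commutatorElement

theorem label_conj (q s : iteratedWreathProduct H) {u : List (Fin m)} (hs : s • u = u) :
    label (q * s * q⁻¹) (q • u) = label q u * label s u * (label q u)⁻¹ := by
  rw [label_mul, label_mul, inv_smul_smul, hs, label_inv_smul]

/-- All nontrivial labels of `g` lie at or below vertices of `V`. -/
def SupportedBelow (g : iteratedWreathProduct H) (V : Set (List (Fin m))) : Prop :=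
  ∀ w, (∀ v ∈ V, ¬ v <+: w) → label g w = 1

section SupportedBelow

variable {g k : iteratedWreathProduct H} {V V' : Set (List (Fin m))}

theorem SupportedBelow.smul_eq (hg : SupportedBelow g V) {w : List (Fin m)}
    (hw : ∀ v ∈ V, v <+: w → v = w) : g • w = w := by
  rw [smul_eq_smul_of_label_eq (k := 1) fun u hu hne => ?_, one_smul]
  rw [label_one, hg u fun v hv hvu => hne (hu.eq_of_length_le ?_)]
  rw [← hw v hv (hvu.trans hu)]
  exact hvu.length_le

theorem SupportedBelow.smul_eq_of_mem (hg : SupportedBelow g V) (hV : IsAntichain (· <+: ·) V)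
    {v : List (Fin m)} (hv : v ∈ V) : g • v = v :=
  hg.smul_eq fun _ hu h => hV.eq hu hv h

theorem SupportedBelow.smul_eq_of_forall_not_prefix (hg : SupportedBelow g V) {w : List (Fin m)}
    (hw : ∀ v ∈ V, ¬ v <+: w) : g • w = w :=
  hg.smul_eq fun v hv h => absurd h (hw v hv)

theorem SupportedBelow.conj (hg : SupportedBelow g V) (q : iteratedWreathProduct H) :
    SupportedBelow (q * g * q⁻¹) ((q • ·) '' V) := by
  intro w hw
  obtain ⟨w, rfl⟩ := MulAction.surjective q w
  have no_prefix : ∀ v ∈ V, ¬ v <+: w := fun v hv h =>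
    hw _ (Set.mem_image_of_mem _ hv) ((smul_prefix_smul_iff q).2 h)
  rw [label_conj q g (hg.smul_eq_of_forall_not_prefix no_prefix), hg w no_prefix,
    mul_one, mul_inv_cancel]

theorem SupportedBelow.commute (hg : SupportedBelow g V) (hk : SupportedBelow k V')
    (hVV' : ∀ v ∈ V, ∀ v' ∈ V', ¬ v <+: v' ∧ ¬ v' <+: v) : Commute g k := by
  have disjoint : Equiv.Perm.Disjoint g.1.1 k.1.1 := fun w => by
    by_contra! h
    obtain ⟨v, hv, hvw⟩ : ∃ v ∈ V, v <+: w := by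
      by_contra! hw
      exact h.1 (hg.smul_eq_of_forall_not_prefix hw)
    obtain ⟨v', hv', hvw'⟩ : ∃ v ∈ V', v <+: w := by
      by_contra! hw
      exact h.2 (hk.smul_eq_of_forall_not_prefix hw)
    exact (List.prefix_or_prefix_of_prefix hvw hvw').elim (hVV' v hv v' hv').1 (hVV' v hv v' hv').2
  exact Subtype.ext (Subtype.ext disjoint.commute)

theorem SupportedBelow.mono (hg : SupportedBelow g V') (h : ∀ v' ∈ V', ∃ v ∈ V, v <+: v') :
    SupportedBelow g V := fun w hw => hg w fun v' hv' hv'w =>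
  let ⟨v, hv, hvv'⟩ := h v' hv'
  hw v hv (hvv'.trans hv'w)

theorem supportedBelow_of_mem_closure {S : Set (iteratedWreathProduct H)}
    (hS : ∀ s ∈ S, SupportedBelow s V) (hg : g ∈ Subgroup.closure S) : SupportedBelow g V := by
  induction hg using Subgroup.closure_induction with
  | mem s hs => exact hS s hs
  | one => exact fun w _ => label_one w
  | mul g k _ _ hg hk =>
    intro w hw
    rw [label_mul, hk.smul_eq_of_forall_not_prefix hw, hg w hw, hk w hw, mul_one]
  | inv g _ hg =>
    intro w hw
    nth_rw 1 [← hg.smul_eq_of_forall_not_prefix hw]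
    rw [label_inv_smul, hg w hw, inv_one]

theorem supportedBelow_of_mem_closedSubgroup {K : Subgroup (iteratedWreathProduct H)}
    (hK : ∀ g ∈ K, SupportedBelow g V) (hg : g ∈ (filtration H).closedSubgroup K) :
    SupportedBelow g V := fun w hw => by
  obtain ⟨s, hs, hgs⟩ :=
    (filtration H).exists_inv_mul_mem_term_of_mem_closure hg (w.length + 1)
  rw [inv_mul_mem_term_iff.1 hgs w w.length.lt_succ_self, hK s hs w hw]

end SupportedBelow

/-! ### Copies of an element below an antichain -/

theorem injective_append {α : Type*} {V : Set (List α)} (hV : IsAntichain (· <+: ·) V) :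
    Function.Injective fun p : V × List α => p.1.1 ++ p.2 := by
  rintro ⟨⟨u, hu⟩, w⟩ ⟨⟨u', hu'⟩, w'⟩ h
  dsimp only at h
  obtain rfl : u = u' := by
    rcases List.prefix_or_prefix_of_prefix (List.prefix_append u w)
      (h ▸ List.prefix_append u' w') with h | h
    · exact hV.eq hu hu' h
    · exact (hV.eq hu' hu h).symm
  rw [List.append_cancel_left h]

/-- The element acting as `g` below each vertex of `V`. -/
noncomputable def spreadFun (V : Set (List (Fin m))) (g : iteratedWreathProduct H) :
    iteratedWreathProduct H :=
  ofPortrait (Function.extend (fun p : V × List (Fin m) => p.1.1 ++ p.2) (fun p => label g p.2) 1)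

section Spread

variable {V : Set (List (Fin m))} (hV : IsAntichain (· <+: ·) V) (g : iteratedWreathProduct H)

theorem supportedBelow_spreadFun : SupportedBelow (spreadFun V g) V := fun w hw => by
  rw [spreadFun, label_ofPortrait, Function.extend_apply', Pi.one_apply]
  rintro ⟨⟨v, u⟩, rfl⟩
  exact hw v v.2 (List.prefix_append _ _)

include hV in
theorem label_spreadFun_append {u : List (Fin m)} (hu : u ∈ V) (w : List (Fin m)) :
    label (spreadFun V g) (u ++ w) = label g w := by
  rw [spreadFun, label_ofPortrait]
  exact (injective_append hV).extend_apply _ _ (⟨u, hu⟩, w)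

include hV in
theorem spreadFun_smul_append {u : List (Fin m)} (hu : u ∈ V) (w : List (Fin m)) :
    spreadFun V g • (u ++ w) = u ++ g • w := by
  induction w using List.reverseRecOn with
  | nil => simp [smul_nil, (supportedBelow_spreadFun g).smul_eq_of_mem hV hu]
  | append_singleton w x ih =>
    rw [← List.append_assoc, smul_concat, smul_concat, ih, label_spreadFun_append hV g hu,
      List.append_assoc]

/-- Acting by the same element below each vertex of the antichain `V`. -/
noncomputable def spread : iteratedWreathProduct H →* iteratedWreathProduct H :=
  MonoidHom.mk' (spreadFun V) fun g k => ext_label fun w => by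
    by_cases hw : ∃ u ∈ V, u <+: w
    · obtain ⟨u, hu, w, rfl⟩ := hw
      simp only [label_mul, spreadFun_smul_append hV _ hu, label_spreadFun_append hV _ hu]
    · push Not at hw
      rw [label_mul, (supportedBelow_spreadFun k).smul_eq_of_forall_not_prefix hw]
      simp only [supportedBelow_spreadFun _ w hw, mul_one]

theorem spread_smul_append {u : List (Fin m)} (hu : u ∈ V) (w : List (Fin m)) :
    spread hV g • (u ++ w) = u ++ g • w :=
  spreadFun_smul_append hV g hu w

theorem supportedBelow_spread : SupportedBelow (spread hV g) V :=
  supportedBelow_spreadFun g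

end Spread

/-! ### Odometers -/

/-- The automorphism with label `h` along the ray `z z z …` and trivial labels elsewhere. -/
def odometer (z : Fin m) (h : H) : iteratedWreathProduct H :=
  ofPortrait fun w => if ∀ x ∈ w, x = z then h else 1

theorem odometer_smul_cons (z : Fin m) (h : H) (x : Fin m) (w : List (Fin m)) :
    odometer z h • (x :: w) = h.1 x :: if x = z then odometer z h • w else w := by
  rw [odometer, ofPortrait_smul_cons]
  by_cases hx : x = z
  · simp [hx]
  · rw [smul_eq_smul_of_label_eq (k := 1) fun v _ _ => by simp [hx, label_one], one_smul]
    simp [hx]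

/-- The group generated by all odometers along a fixed ray. -/
def odometerGroup (H : Subgroup (Equiv.Perm (Fin m))) (z : Fin m) :
    Subgroup (iteratedWreathProduct H) :=
  Subgroup.closure (Set.range (odometer z))

theorem odometer_mem_odometerGroup (z : Fin m) (h : H) : odometer z h ∈ odometerGroup H z :=
  Subgroup.subset_closure ⟨h, rfl⟩

theorem exists_mem_odometerGroup_smul_cons (z : Fin m) {t : iteratedWreathProduct H}
    (ht : t ∈ odometerGroup H z) :
    ∃ s ∈ odometerGroup H z, ∀ w : List (Fin m), s • (z :: w) = z :: t • w := by
  induction ht using Subgroup.closure_induction with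
  | mem t ht =>
    obtain ⟨h, rfl⟩ := ht
    by_cases hz : h.1 z = z
    · exact ⟨odometer z h, odometer_mem_odometerGroup z h, fun w => by
        simp [odometer_smul_cons, hz]⟩
    · exact ⟨odometer z h⁻¹ * odometer z h, mul_mem (odometer_mem_odometerGroup z _)
        (odometer_mem_odometerGroup z _), fun w => by simp [mul_smul, odometer_smul_cons, hz]⟩
  | one => exact ⟨1, one_mem _, by simp⟩
  | mul a b _ _ ha hb =>
    obtain ⟨s, hs, hs'⟩ := ha
    obtain ⟨t, ht, ht'⟩ := hb
    exact ⟨s * t, mul_mem hs ht, fun w => by simp [mul_smul, hs', ht']⟩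
  | inv a _ ha =>
    obtain ⟨s, hs, hs'⟩ := ha
    exact ⟨s⁻¹, inv_mem hs, fun w => by rw [inv_smul_eq_iff, hs', smul_inv_smul]⟩

theorem exists_mem_odometerGroup_smul_eq_replicate (hH : MulAction.IsPretransitive H (Fin m))
    (z : Fin m) (w : List (Fin m)) :
    ∃ t ∈ odometerGroup H z, t • w = List.replicate w.length z := by
  induction hn : w.length generalizing w with
  | zero => exact ⟨1, one_mem _, by simpa using hn⟩
  | succ n ih =>
    obtain ⟨x, w, rfl⟩ := List.exists_of_length_succ w hn
    obtain ⟨h, hhx : h.1 x = z⟩ := hH.exists_smul_eq x z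
    obtain ⟨w', hw', hl⟩ : ∃ w', odometer z h • (x :: w) = z :: w' ∧ w'.length = n := by
      refine ⟨_, by rw [odometer_smul_cons, hhx], ?_⟩
      split_ifs <;> simpa [length_smul] using hn
    obtain ⟨t, ht, htw⟩ := ih w' hl
    obtain ⟨s, hs, hs'⟩ := exists_mem_odometerGroup_smul_cons z ht
    exact ⟨s * odometer z h, mul_mem hs (odometer_mem_odometerGroup z h), by
      rw [mul_smul, hw', hs', htw, List.replicate_succ]⟩

theorem exists_mem_odometerGroup_smul_eq (hH : MulAction.IsPretransitive H (Fin m))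
    (z : Fin m) {v w : List (Fin m)} (h : v.length = w.length) :
    ∃ t ∈ odometerGroup H z, t • v = w := by
  obtain ⟨t, ht, htv⟩ := exists_mem_odometerGroup_smul_eq_replicate hH z v
  obtain ⟨s, hs, hsw⟩ := exists_mem_odometerGroup_smul_eq_replicate hH z w
  exact ⟨s⁻¹ * t, mul_mem (inv_mem hs) ht, by rw [mul_smul, htv, h, ← hsw, inv_smul_smul]⟩

theorem spread_mem_of_mem_odometerGroup {K : Subgroup (iteratedWreathProduct H)} {z : Fin m}
    {V : Set (List (Fin m))} {hV : IsAntichain (· <+: ·) V}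
    (hK : ∀ h : H, spread hV (odometer z h) ∈ K) {t : iteratedWreathProduct H}
    (ht : t ∈ odometerGroup H z) : spread hV t ∈ K := by
  have : odometerGroup H z ≤ K.comap (spread hV) :=
    (Subgroup.closure_le _).2 (Set.range_subset_iff.2 hK)
  exact this ht

/-- The label at the root, as a homomorphism. -/
noncomputable def rootLabel : iteratedWreathProduct H →* H :=
  MonoidHom.mk' (fun g => label g []) fun g k => by rw [label_mul, smul_nil]

theorem smul_singleton (g : iteratedWreathProduct H) (x : Fin m) :
    g • [x] = [(rootLabel g).1 x] :=
  (smul_concat g [] x).trans (by rw [smul_nil]; rfl)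

theorem rootLabel_odometer (z : Fin m) (h : H) : rootLabel (odometer z h) = h :=
  (label_ofPortrait _ _).trans (by simp)

theorem odometer_pow_smul_cons (z : Fin m) (σ : H) (j : ℕ) (hj : j < MulAction.period σ z)
    (w : List (Fin m)) :
    odometer z σ ^ (j + 1) • (z :: w) = (σ ^ (j + 1)).1 z :: odometer z σ • w := by
  induction j with
  | zero => simp [odometer_smul_cons]
  | succ j ih =>
    have pow_apply_ne : (σ ^ (j + 1)).1 z ≠ z := fun h =>
      Nat.not_dvd_of_pos_of_lt j.succ_pos hj
        (MulAction.pow_smul_eq_iff_period_dvd.1 (show σ ^ (j + 1) • z = z from h))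
    rw [pow_succ', mul_smul, ih (Nat.lt_of_succ_lt hj), odometer_smul_cons, if_neg pow_apply_ne]
    simp [pow_succ' σ (j + 1)]

theorem odometer_pow_period_smul_cons (z : Fin m) (σ : H) (w : List (Fin m)) :
    odometer z σ ^ MulAction.period σ z • (z :: w) = z :: odometer z σ • w := by
  have period_pos := MulAction.period_pos_of_orderOf_pos (orderOf_pos σ) z
  have h := odometer_pow_smul_cons z σ (MulAction.period σ z - 1) (by omega) w
  rw [Nat.sub_add_cancel period_pos] at h
  rw [h]
  exact congrArg (· :: _) (MulAction.pow_period_smul σ z)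

theorem odometer_zpow_smul_cons (z : Fin m) (σ : H) (k : ℤ) (w : List (Fin m)) :
    odometer z σ ^ ((MulAction.period σ z : ℤ) * k) • (z :: w) = z :: odometer z σ ^ k • w := by
  rw [zpow_mul, zpow_natCast]
  induction k using Int.induction_on with
  | zero => simp
  | succ k ih =>
    rw [add_comm, zpow_one_add, mul_smul, ih, odometer_pow_period_smul_cons, zpow_one_add, mul_smul]
  | pred k ih =>
    rw [sub_eq_neg_add, zpow_add, mul_smul, ih, zpow_add, mul_smul, zpow_neg_one, zpow_neg_one,
      inv_smul_eq_iff, odometer_pow_period_smul_cons, smul_inv_smul]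

theorem odometer_zpow_smul_replicate_iff (z : Fin m) (σ : H) (l : ℕ) (k : ℤ) :
    odometer z σ ^ k • List.replicate l z = List.replicate l z ↔
      (MulAction.period σ z : ℤ) ^ l ∣ k := by
  induction l generalizing k with
  | zero => simp [smul_nil]
  | succ l ih =>
    constructor
    · intro h
      have smul_z : odometer z σ ^ k • [z] = [z] := by
        simpa [take_smul] using congrArg (List.take 1) h
      rw [smul_singleton, map_zpow, rootLabel_odometer, List.singleton_inj] at smul_z
      obtain ⟨k, rfl⟩ :=
        MulAction.zpow_smul_eq_iff_period_dvd.1 (show σ ^ k • z = z from smul_z)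
      rw [List.replicate_succ, odometer_zpow_smul_cons, List.cons_inj_right] at h
      rw [pow_succ']
      exact mul_dvd_mul_left _ ((ih k).1 h)
    · rintro ⟨k, rfl⟩
      rw [pow_succ', mul_assoc, List.replicate_succ, odometer_zpow_smul_cons,
        (ih _).2 (dvd_mul_right _ _)]

/-! ### Isolating a label by a commutator -/

/-- The element with label `h` at each vertex of `V` and trivial labels elsewhere. -/
noncomputable def constantOn (V : Set (List (Fin m))) (h : H) : iteratedWreathProduct H :=
  ofPortrait (V.mulIndicator fun _ => h)

theorem supportedBelow_constantOn (V : Set (List (Fin m))) (h : H) :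
    SupportedBelow (constantOn V h) V := fun w hw =>
  (label_ofPortrait _ w).trans (Set.mulIndicator_of_notMem (fun hwV => hw w hwV List.prefix_rfl) _)

theorem constantOn_singleton_mul_sdiff {V : Set (List (Fin m))} (hV : IsAntichain (· <+: ·) V)
    {u : List (Fin m)} (hu : u ∈ V) (h : H) :
    constantOn {u} h * constantOn (V \ {u}) h = constantOn V h := by
  have smul_eq : ∀ v ∈ V, constantOn (V \ {u}) h • v = v := fun v hv =>
    (supportedBelow_constantOn _ h).smul_eq fun w hw hwv => hV.eq hw.1 hv hwv
  refine ext_label fun v => ?_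
  rw [label_mul]
  by_cases hv : v ∈ V
  · rw [smul_eq v hv]
    by_cases hvu : v = u <;> simp [constantOn, hv, hvu, hu]
  · have smul_ne : constantOn (V \ {u}) h • v ≠ u := fun hvu => hv <| by
      rwa [smul_left_cancel _ (hvu.trans (smul_eq u hu).symm)]
    simp [constantOn, hv] at smul_ne ⊢
    simp [smul_ne]

theorem constantOn_smul_append {V : Set (List (Fin m))} (hV : IsAntichain (· <+: ·) V) (h : H)
    {u : List (Fin m)} (hu : u ∈ V) (x : Fin m) (w : List (Fin m)) :
    constantOn V h • (u ++ x :: w) = u ++ h.1 x :: w := by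
  induction w using List.reverseRecOn with
  | nil =>
    rw [smul_concat, (supportedBelow_constantOn V h).smul_eq_of_mem hV hu, constantOn,
      label_ofPortrait, Set.mulIndicator_of_mem hu]
  | append_singleton w y ih =>
    have notMem : u ++ x :: w ∉ V := fun hw => by
      simpa using hV.eq hu hw (List.prefix_append u _)
    rw [← List.cons_append, ← List.append_assoc, smul_concat, ih, constantOn, label_ofPortrait,
      Set.mulIndicator_of_notMem notMem]
    simp

theorem commutatorElement_conj_constantOn {D P : Set (List (Fin m))}
    (hD : IsAntichain (· <+: ·) D) (hP : IsAntichain (· <+: ·) P) (y : iteratedWreathProduct H)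
    {u p : List (Fin m)} (hu : u ∈ D) (hp : p ∈ P)
    (eq_of_comparable : ∀ u' ∈ D, ∀ p' ∈ P, y • u' <+: p' ∨ p' <+: y • u' → u' = u ∧ p' = p)
    (k σ : H) :
    ⁅y * constantOn D k * y⁻¹, constantOn P σ⁆ =
      ⁅y * constantOn {u} k * y⁻¹, constantOn {p} σ⁆ := by
  have commute : ∀ D' ⊆ D, ∀ P' ⊆ P, (u ∈ D' → p ∉ P') →
      Commute (y * constantOn D' k * y⁻¹) (constantOn P' σ) := fun D' hD' P' hP' h => by
    refine ((supportedBelow_constantOn D' k).conj y).commute (supportedBelow_constantOn P' σ) ?_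
    rintro _ ⟨u', hu', rfl⟩ p' hp'
    rw [← not_or]
    intro hcomparable
    obtain ⟨rfl, rfl⟩ := eq_of_comparable u' (hD' hu') p' (hP' hp') hcomparable
    exact h hu' hp'
  rw [← constantOn_singleton_mul_sdiff hD hu, ← constantOn_singleton_mul_sdiff hP hp,
    show y * (constantOn {u} k * constantOn (D \ {u}) k) * y⁻¹ =
      (y * constantOn {u} k * y⁻¹) * (y * constantOn (D \ {u}) k * y⁻¹) by group]
  refine commutatorElement_mul_mul_of_commute ?_ ?_ ?_
  · exact commute _ Set.sdiff_subset _ (Set.singleton_subset_iff.2 hp) (by simp)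
  · exact commute _ Set.sdiff_subset _ Set.sdiff_subset (by simp)
  · exact commute _ (Set.singleton_subset_iff.2 hu) _ Set.sdiff_subset (by simp)

/-- `K` realizes every label at `u` by elements fixing the level of `u`, with no other label on
that level except possibly at `w`. -/
def Isolates (K : Subgroup (iteratedWreathProduct H)) (u w : List (Fin m)) : Prop :=
  ∀ h : H, ∃ s ∈ K, s ∈ (filtration H).term u.length ∧
    ∀ v, v.length = u.length → v ≠ w → label s v = (Pi.mulSingle u h : List (Fin m) → H) v

theorem label_conj_eq_mulSingle {s : iteratedWreathProduct H} {u v : List (Fin m)} {k : H}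
    (hs : s • v = v) (hk : label s v = (Pi.mulSingle u k : List (Fin m) → H) v)
    (q : iteratedWreathProduct H) :
    label (q * s * q⁻¹) (q • v) =
      (Pi.mulSingle (q • u) (label q u * k * (label q u)⁻¹) : List (Fin m) → H) (q • v) := by
  rw [label_conj q s hs, hk]
  by_cases hvu : v = u
  · rw [hvu, Pi.mulSingle_eq_same, Pi.mulSingle_eq_same]
  · rw [Pi.mulSingle_eq_of_ne hvu, Pi.mulSingle_eq_of_ne (by simpa using hvu), mul_one,
      mul_inv_cancel]

theorem Isolates.smul {K : Subgroup (iteratedWreathProduct H)} {u w : List (Fin m)}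
    (h : Isolates K u w) {q : iteratedWreathProduct H} (hq : q ∈ K) :
    Isolates K (q • u) (q • w) := by
  intro k
  obtain ⟨s, hsK, hs, label_s⟩ := h ((label q u)⁻¹ * k * label q u)
  refine ⟨q * s * q⁻¹, K.mul_mem (K.mul_mem hq hsK) (K.inv_mem hq), ?_, fun v hv hvw => ?_⟩
  · rw [length_smul]
    exact ((filtration H).normal _).conj_mem s hs q
  · obtain ⟨v, rfl⟩ := MulAction.surjective q v
    rw [length_smul, length_smul] at hv
    rw [label_conj_eq_mulSingle (smul_eq_of_mem_term hs hv.le)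
      (label_s v hv fun h => hvw (h ▸ rfl)) q]
    congr 1
    group

theorem label_commutatorElement_smul (x f : iteratedWreathProduct H) {v : List (Fin m)}
    (hv : x • v = v) :
    label ⁅x, f⁆ (f • v) =
      label x (f • v) * label f v * (label x v)⁻¹ * (label f v)⁻¹ := by
  have label_x_inv : label x⁻¹ v = (label x v)⁻¹ := by simpa [hv] using label_inv_smul x v
  rw [commutatorElement_def, label_mul, label_mul, label_mul, inv_smul_smul,
    inv_smul_eq_iff.2 hv.symm, label_inv_smul, label_x_inv]

/-- The commutator of `x` with `f` is `x` times an element whose only label on the level of `u`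
is at `f • u`. -/
theorem isolates_of_commutatorElement_mem {K : Subgroup (iteratedWreathProduct H)}
    {y f : iteratedWreathProduct H} {u : List (Fin m)}
    (hK : ∀ k : H, ⁅y * constantOn {u} k * y⁻¹, f⁆ ∈ K) : Isolates K (y • u) (f • y • u) := by
  intro h
  set k := (label y u)⁻¹ * h * label y u with hk
  have constantOn_mem : constantOn {u} k ∈ (filtration H).term u.length :=
    mem_term_iff.2 fun v hv =>
      supportedBelow_constantOn _ _ v fun w hw hwv => hwv.length_le.not_gt (hw ▸ hv)
  have conj_mem : y * constantOn {u} k * y⁻¹ ∈ (filtration H).term (y • u).length := by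
    rw [length_smul]
    exact ((filtration H).normal _).conj_mem _ constantOn_mem y
  have label_conj_constantOn : ∀ v, v.length = (y • u).length →
      label (y * constantOn {u} k * y⁻¹) v = (Pi.mulSingle (y • u) h : List (Fin m) → H) v := by
    intro v hv
    obtain ⟨v, rfl⟩ := MulAction.surjective y v
    rw [length_smul, length_smul] at hv
    rw [label_conj_eq_mulSingle (smul_eq_of_mem_term constantOn_mem hv.le) (u := u) (k := k)
      (by simp [constantOn, Pi.mulSingle_apply]), hk]
    congr 1
    group
  refine ⟨_, hK k, ?_, fun v hv hvf => ?_⟩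
  · rw [commutatorElement_def, mul_assoc, mul_assoc, ← mul_assoc f]
    exact mul_mem conj_mem (((filtration H).normal _).conj_mem _ (inv_mem conj_mem) f)
  · obtain ⟨v, rfl⟩ := MulAction.surjective f v
    rw [label_commutatorElement_smul _ f
        (smul_eq_of_mem_term conj_mem ((length_smul f v).symm.trans hv).le),
      label_conj_constantOn _ hv, label_conj_constantOn v ((length_smul f v).symm.trans hv),
      Pi.mulSingle_eq_of_ne (i' := v) fun h => hvf (h ▸ rfl)]
    simp

/-! ### Coding -/

theorem mem_iff_of_sum_pow_modEq {r L : ℕ} (hr : 2 ≤ r) {S S' : Finset ℕ}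
    (h : ∑ t ∈ S, r ^ t ≡ ∑ t ∈ S', r ^ t [MOD r ^ L]) {t : ℕ} (ht : t < L) :
    t ∈ S ↔ t ∈ S' := by
  have sum_filter_modEq : ∀ A : Finset ℕ,
      ∑ t ∈ A with t < L, r ^ t ≡ ∑ t ∈ A, r ^ t [MOD r ^ L] := by
    intro A
    rw [← Finset.sum_filter_add_sum_filter_not A (· < L)]
    exact Nat.left_modEq_add_iff.2 (Finset.dvd_sum fun i hi =>
      pow_dvd_pow r (not_lt.1 (Finset.mem_filter.1 hi).2))
  have sum_filter_lt : ∀ A : Finset ℕ, ∑ t ∈ A with t < L, r ^ t < r ^ L := fun A =>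
    Nat.geomSum_lt hr fun k hk => (Finset.mem_filter.1 hk).2
  have filter_eq : ({t ∈ S | t < L} : Finset ℕ) = {t ∈ S' | t < L} :=
    Finset.geomSum_injective hr <|
      (((sum_filter_modEq S).trans h).trans (sum_filter_modEq S').symm).eq_of_lt_of_lt
        (sum_filter_lt S) (sum_filter_lt S')
  simpa [ht] using Finset.ext_iff.1 filter_eq t

/-- The integer with base-`r` digits `1` at the even places `2 * s.1` and `2 * s.2`; multiplication
by `r` moves its digits to odd places. -/
def code (r : ℕ) (s : ℕ × ℕ) : ℤ := (r : ℤ) ^ (2 * s.1) + (r : ℤ) ^ (2 * s.2)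

theorem sum_pow_eq_code {r : ℕ} {s t : ℕ × ℕ} (hs : s.1 < s.2) (ht : t.1 < t.2) :
    ((∑ i ∈ ({2 * s.1, 2 * s.2, 2 * t.1 + 1, 2 * t.2 + 1} : Finset ℕ), r ^ i : ℕ) : ℤ) =
      code r s + r * code r t := by
  rw [Finset.sum_insert, Finset.sum_insert, Finset.sum_insert, Finset.sum_singleton]
  · simp only [code]; push_cast; ring
  all_goals simp; try omega

theorem code_separated {r : ℕ} (hr : 2 ≤ r) {s s' s'' : ℕ × ℕ} (hs : s.1 < s.2)
    (hs' : s'.1 < s'.2) (hs'' : s''.1 < s''.2)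
    (h : (r : ℤ) ^ min (2 * s'.2 + 2) (2 * s''.2 + 2) ∣
      r * code r s - r * code r s' + code r s' - code r s'') : s = s' ∧ s' = s'' := by
  have modEq : ∑ i ∈ ({2 * s''.1, 2 * s''.2, 2 * s'.1 + 1, 2 * s'.2 + 1} : Finset ℕ), r ^ i ≡
      ∑ i ∈ ({2 * s'.1, 2 * s'.2, 2 * s.1 + 1, 2 * s.2 + 1} : Finset ℕ), r ^ i
        [MOD r ^ min (2 * s'.2 + 2) (2 * s''.2 + 2)] := by
    rw [Nat.modEq_iff_dvd, sum_pow_eq_code hs' hs, sum_pow_eq_code hs'' hs']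
    push_cast
    convert h using 1
    ring
  have digit_iff := fun t (ht : t < min (2 * s'.2 + 2) (2 * s''.2 + 2)) =>
    mem_iff_of_sum_pow_modEq hr modEq ht
  simp only [Finset.mem_insert, Finset.mem_singleton] at digit_iff
  obtain ⟨i, n⟩ := s
  obtain ⟨i', n'⟩ := s'
  obtain ⟨i'', n''⟩ := s''
  simp only [Prod.mk.injEq] at *
  obtain ⟨rfl, rfl⟩ : i' = i'' ∧ n' = n'' := by
    rcases le_total n' n'' with hn | hn
    · have := digit_iff (2 * i') (by omega)
      have := digit_iff (2 * n') (by omega)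
      omega
    · have := digit_iff (2 * i'') (by omega)
      have := digit_iff (2 * n'') (by omega)
      omega
  have := digit_iff (2 * i' + 1) (by omega)
  have := digit_iff (2 * n' + 1) (by omega)
  omega

theorem prefix_or_prefix_of_append {α : Type*} {a b c d : List α}
    (h : a ++ b <+: c ++ d ∨ c ++ d <+: a ++ b) : a <+: c ∨ c <+: a := by
  rcases h with h | h
  · exact List.prefix_or_prefix_of_prefix ((List.prefix_append a b).trans h)
      (List.prefix_append c d)
  · exact List.prefix_or_prefix_of_prefix (List.prefix_append a b)
      ((List.prefix_append c d).trans h)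

theorem eq_and_prefix_or_prefix_of_append {α : Type*} {A : Set (List α)}
    (hA : IsAntichain (· <+: ·) A) {v v' a a' : List α} (hv : v ∈ A) (hv' : v' ∈ A)
    (h : v ++ a <+: v' ++ a' ∨ v' ++ a' <+: v ++ a) : v = v' ∧ (a <+: a' ∨ a' <+: a) := by
  obtain rfl : v = v' := by
    rcases prefix_or_prefix_of_append h with h' | h'
    · exact hA.eq hv hv' h'
    · exact (hA.eq hv' hv h').symm
  exact ⟨rfl, by simpa only [List.prefix_append_right_inj] using h⟩

/-- The words `v ++ P v n` with `v ∈ A` and `encode v < n`: one for each vertex of `A` and each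
large `n`. -/
def familyBelow {α : Type*} [Encodable α] (A : Set (List α)) (P : List α → ℕ → List α) :
    Set (List α) :=
  {w | ∃ v ∈ A, ∃ n, Encodable.encode v < n ∧ w = v ++ P v n}

theorem exists_prefix_of_mem_familyBelow {α : Type*} [Encodable α] {A : Set (List α)}
    {P : List α → ℕ → List α} {w : List α} (hw : w ∈ familyBelow A P) : ∃ v ∈ A, v <+: w := by
  obtain ⟨v, hv, n, -, rfl⟩ := hw
  exact ⟨v, hv, List.prefix_append _ _⟩

theorem isAntichain_familyBelow {α : Type*} [Encodable α] {A : Set (List α)}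
    (hA : IsAntichain (· <+: ·) A) {P : List α → ℕ → List α}
    (hP : ∀ v n n', Encodable.encode v < n → Encodable.encode v < n' →
      P v n <+: P v n' → n = n') :
    IsAntichain (· <+: ·) (familyBelow A P) := by
  rintro _ ⟨v, hv, n, hn, rfl⟩ _ ⟨v', hv', n', hn', rfl⟩ hne h
  obtain ⟨rfl, -⟩ := eq_and_prefix_or_prefix_of_append hA hv hv' (Or.inl h)
  obtain rfl := hP v n n' hn hn' ((List.prefix_append_right_inj v).1 h)
  exact hne rfl

section Site

variable (z : Fin m) (σ : H)

/-- The word below `v` coding the pair `(v, n)`. -/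
noncomputable def site (v : List (Fin m)) (n : ℕ) : List (Fin m) :=
  odometer z σ ^ code (MulAction.period σ z) (Encodable.encode v, n) •
    List.replicate (2 * n + 2) z

/-- The exponent of the odometer moving `deepSite z σ e v n` below `site z σ v n`. -/
noncomputable def shift (v : List (Fin m)) (n : ℕ) : ℤ :=
  MulAction.period σ z * code (MulAction.period σ z) (Encodable.encode v, n)

/-- The preimage of the vertex `z … z` below `site z σ v n` under a power of the odometer that
depends on `(v, n)`. -/
noncomputable def deepSite (e : ℕ) (v : List (Fin m)) (n : ℕ) : List (Fin m) :=
  odometer z σ ^ (-shift z σ v n) • (site z σ v n ++ z :: List.replicate (2 * n + e) z)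

theorem length_site (v : List (Fin m)) (n : ℕ) : (site z σ v n).length = 2 * n + 2 := by
  simp [site, length_smul]

theorem pow_min_dvd_of_prefix_or_prefix {a b : ℤ} {l l' : ℕ}
    (h : odometer z σ ^ a • List.replicate l z <+: odometer z σ ^ b • List.replicate l' z ∨
      odometer z σ ^ b • List.replicate l' z <+: odometer z σ ^ a • List.replicate l z) :
    (MulAction.period σ z : ℤ) ^ min l l' ∣ a - b := by
  wlog hprefix : odometer z σ ^ a • List.replicate l z <+: odometer z σ ^ b • List.replicate l' z
    generalizing a b l l'
  · rw [min_comm, ← dvd_neg, neg_sub]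
    exact this h.symm (h.resolve_left hprefix)
  have hl : l ≤ l' := by simpa [length_smul] using hprefix.length_le
  rw [min_eq_left hl, ← odometer_zpow_smul_replicate_iff, sub_eq_neg_add, zpow_add, mul_smul,
    zpow_neg, inv_smul_eq_iff]
  rw [List.prefix_iff_eq_take, take_smul, List.take_replicate] at hprefix
  simpa [length_smul, hl] using hprefix

theorem two_le_period {z : Fin m} {σ : H} (hσ : σ.1 z ≠ z) : 2 ≤ MulAction.period σ z :=
  (Nat.two_le_iff _).2 ⟨(MulAction.period_pos_of_orderOf_pos (orderOf_pos σ) z).ne',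
    fun h => hσ (MulAction.period_eq_one_iff.1 h)⟩

variable {z σ} {v v' v'' : List (Fin m)} {n n' n'' : ℕ}

theorem eq_of_site_prefix_or_prefix (hσ : σ.1 z ≠ z) (hn : Encodable.encode v < n)
    (hn' : Encodable.encode v' < n') (hn'' : Encodable.encode v'' < n'') {a b : List (Fin m)}
    (h : odometer z σ ^ (shift z σ v n - shift z σ v' n') • (site z σ v' n' ++ a) <+:
        site z σ v'' n'' ++ b ∨
      site z σ v'' n'' ++ b <+:
        odometer z σ ^ (shift z σ v n - shift z σ v' n') • (site z σ v' n' ++ a)) :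
    (v = v' ∧ n = n') ∧ v' = v'' ∧ n' = n'' := by
  obtain ⟨t, -, ht⟩ := exists_smul_append_eq
    (odometer z σ ^ (shift z σ v n - shift z σ v' n')) (site z σ v' n') a
  rw [ht] at h
  replace h := prefix_or_prefix_of_append h
  simp only [site, ← mul_smul, ← zpow_add] at h
  simpa using code_separated (two_le_period hσ) (s := (Encodable.encode v, n))
    (s' := (Encodable.encode v', n')) (s'' := (Encodable.encode v'', n'')) hn hn' hn''
    (pow_min_dvd_of_prefix_or_prefix z σ h)

theorem eq_of_site_append_prefix (hσ : σ.1 z ≠ z) (hn : Encodable.encode v < n)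
    (hn' : Encodable.encode v' < n') {a b : List (Fin m)}
    (h : site z σ v n ++ a <+: site z σ v' n' ++ b) : v = v' ∧ n = n' :=
  (eq_of_site_prefix_or_prefix hσ hn hn hn' (a := a) (b := b) (Or.inl (by simpa using h))).2

theorem eq_of_deepSite_prefix (hσ : σ.1 z ≠ z) {e : ℕ} (hn : Encodable.encode v < n)
    (hn' : Encodable.encode v' < n') (h : deepSite z σ e v n <+: deepSite z σ e v' n') :
    v = v' ∧ n = n' := by
  rw [deepSite, deepSite, ← smul_prefix_smul_iff (odometer z σ ^ shift z σ v' n'), ← mul_smul,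
    ← mul_smul, ← zpow_add, ← zpow_add, add_neg_cancel, zpow_zero, one_smul, ← sub_eq_add_neg] at h
  exact (eq_of_site_prefix_or_prefix hσ hn' hn hn' (Or.inl h)).2

end Site

section Family

variable {z : Fin m} {σ : H} (hσ : σ.1 z ≠ z) {A : Set (List (Fin m))}
  (hA : IsAntichain (· <+: ·) A)

include hσ hA

theorem isAntichain_familyBelow_site_append (a : List (Fin m)) :
    IsAntichain (· <+: ·) (familyBelow A fun v n => site z σ v n ++ a) :=
  isAntichain_familyBelow hA fun _ _ _ hn hn' h => (eq_of_site_append_prefix hσ hn hn' h).2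

theorem isAntichain_familyBelow_deepSite (e : ℕ) :
    IsAntichain (· <+: ·) (familyBelow A (deepSite z σ e)) :=
  isAntichain_familyBelow hA fun _ _ _ hn hn' h => (eq_of_deepSite_prefix hσ hn hn' h).2

theorem isolates_site {K : Subgroup (iteratedWreathProduct H)} {e : ℕ}
    (hodometer : ∀ h : H, spread hA (odometer z h) ∈ K)
    (hsite : constantOn (familyBelow A (site z σ)) σ ∈ K)
    (hdeepSite : ∀ h : H, constantOn (familyBelow A (deepSite z σ e)) h ∈ K)
    {v : List (Fin m)} (hv : v ∈ A) {n : ℕ} (hn : Encodable.encode v < n) :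
    Isolates K (v ++ site z σ v n ++ z :: List.replicate (2 * n + e) z)
      (v ++ site z σ v n ++ σ.1 z :: List.replicate (2 * n + e) z) := by
  set y := spread hA (odometer z σ ^ shift z σ v n) with hy
  have hyK : y ∈ K := by rw [hy, map_zpow]; exact K.zpow_mem (hodometer σ) _
  have y_smul : y • (v ++ deepSite z σ e v n) =
      v ++ site z σ v n ++ z :: List.replicate (2 * n + e) z := by
    rw [hy, spread_smul_append hA _ hv, deepSite, zpow_neg, smul_inv_smul, List.append_assoc]
  have eq_of_comparable : ∀ u ∈ familyBelow A (deepSite z σ e), ∀ p ∈ familyBelow A (site z σ),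
      y • u <+: p ∨ p <+: y • u → u = v ++ deepSite z σ e v n ∧ p = v ++ site z σ v n := by
    rintro _ ⟨v', hv', n', hn', rfl⟩ _ ⟨v'', hv'', n'', hn'', rfl⟩ h
    rw [hy, spread_smul_append hA _ hv', deepSite, ← mul_smul, ← zpow_add, ← sub_eq_add_neg] at h
    obtain ⟨rfl, h⟩ := eq_and_prefix_or_prefix_of_append hA hv' hv'' h
    obtain ⟨⟨rfl, rfl⟩, -, rfl⟩ := eq_of_site_prefix_or_prefix hσ hn hn' hn'' (b := [])
      (by simpa using h)
    exact ⟨rfl, rfl⟩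
  have commutator_mem : ∀ k : H, ⁅y * constantOn {v ++ deepSite z σ e v n} k * y⁻¹,
      constantOn {v ++ site z σ v n} σ⁆ ∈ K := fun k => by
    have hx : y * constantOn (familyBelow A (deepSite z σ e)) k * y⁻¹ ∈ K :=
      K.mul_mem (K.mul_mem hyK (hdeepSite k)) (K.inv_mem hyK)
    have hdeep : v ++ deepSite z σ e v n ∈ familyBelow A (deepSite z σ e) := ⟨v, hv, n, hn, rfl⟩
    have hplain : v ++ site z σ v n ∈ familyBelow A (site z σ) := ⟨v, hv, n, hn, rfl⟩
    rw [← commutatorElement_conj_constantOn (isAntichain_familyBelow_deepSite hσ hA e)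
      (by simpa using isAntichain_familyBelow_site_append hσ hA []) y hdeep hplain eq_of_comparable]
    exact K.mul_mem (K.mul_mem (K.mul_mem hx hsite) (K.inv_mem hx)) (K.inv_mem hsite)
  have isolates := isolates_of_commutatorElement_mem commutator_mem
  rwa [y_smul, constantOn_smul_append (V := {v ++ site z σ v n})
    (Set.subsingleton_singleton.isAntichain _) σ rfl] at isolates

theorem exists_isolates (hH : MulAction.IsPretransitive H (Fin m))
    {K : Subgroup (iteratedWreathProduct H)} {e : ℕ}
    (hodometer : ∀ h : H, spread hA (odometer z h) ∈ K)
    (hchild : ∀ h : H, spread (isAntichain_familyBelow_site_append hσ hA [z]) (odometer z h) ∈ K)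
    (hsite : constantOn (familyBelow A (site z σ)) σ ∈ K)
    (hdeepSite : ∀ h : H, constantOn (familyBelow A (deepSite z σ e)) h ∈ K)
    {v : List (Fin m)} (hv : v ∈ A) {n : ℕ} (hn : Encodable.encode v < n)
    {c : List (Fin m)} (hc : c.length = 2 * n + 3) :
    ∃ w, ∀ y : List (Fin m), y.length = 2 * n + e → Isolates K (v ++ c ++ y) w := by
  obtain ⟨t, ht, rfl⟩ := exists_mem_odometerGroup_smul_eq hH z (v := site z σ v n ++ [z])
    (w := c) (by simp [hc, length_site])
  refine ⟨spread hA t • (v ++ site z σ v n ++ σ.1 z :: List.replicate (2 * n + e) z),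
    fun y hy => ?_⟩
  obtain ⟨y', hy', smul_prefix⟩ := exists_smul_append_eq t⁻¹ (t • (site z σ v n ++ [z])) y
  obtain ⟨s, hs, rfl⟩ := exists_mem_odometerGroup_smul_eq hH z
    (v := List.replicate (2 * n + e) z) (w := y') (by simp [hy', hy])
  rw [inv_smul_smul, inv_smul_eq_iff] at smul_prefix
  set g := spread (isAntichain_familyBelow_site_append hσ hA [z]) s with hg
  have g_smul : g • (v ++ site z σ v n ++ z :: List.replicate (2 * n + e) z) =
      v ++ (site z σ v n ++ [z] ++ s • List.replicate (2 * n + e) z) := by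
    have := spread_smul_append (isAntichain_familyBelow_site_append hσ hA [z]) s
      ⟨v, hv, n, hn, rfl⟩ (List.replicate (2 * n + e) z)
    simpa [hg] using this
  have g_smul_partner : g • (v ++ site z σ v n ++ σ.1 z :: List.replicate (2 * n + e) z) =
      v ++ site z σ v n ++ σ.1 z :: List.replicate (2 * n + e) z := by
    refine (supportedBelow_spread _ s).smul_eq ?_
    rintro _ ⟨v', hv', n', hn', rfl⟩ h
    rw [List.append_assoc] at h
    obtain ⟨rfl, -⟩ := eq_and_prefix_or_prefix_of_append hA hv' hv (Or.inl h)
    rw [List.prefix_append_right_inj] at h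
    obtain ⟨-, rfl⟩ := eq_of_site_append_prefix hσ hn' hn h
    rw [List.prefix_append_right_inj] at h
    exact absurd (List.cons_prefix_cons.1 h).1.symm hσ
  have isolates := ((isolates_site hσ hA hodometer hsite hdeepSite hv hn).smul
    (spread_mem_of_mem_odometerGroup hchild hs)).smul (spread_mem_of_mem_odometerGroup hodometer ht)
  rwa [← hg, g_smul, g_smul_partner, spread_smul_append hA t hv, ← smul_prefix,
    ← List.append_assoc] at isolates

end Family

/-! ### Sets of words of given density -/

/-- The number whose base-`m` digits, most significant first, are the letters of `w`. -/
def wordValue (w : List (Fin m)) : ℕ := Nat.ofDigits m (w.map Fin.val).reverse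

theorem wordValue_concat (w : List (Fin m)) (x : Fin m) :
    wordValue (w ++ [x]) = x + m * wordValue w := by
  simp [wordValue, Nat.ofDigits_cons]

theorem wordValue_lt (hm : 1 < m) (w : List (Fin m)) : wordValue w < m ^ w.length := by
  simpa [wordValue] using Nat.ofDigits_lt_base_pow_length (l := (w.map Fin.val).reverse) hm
    (by simp)

theorem injOn_wordValue (hm : 1 < m) (U : Set (List (Fin m))) (n : ℕ) :
    Set.InjOn wordValue (levelSet U n) := by
  rintro w ⟨-, hw⟩ w' ⟨-, hw'⟩ h
  have digits_eq := Nat.ofDigits_inj_of_len_eq hm (by simp [hw, hw']) (by simp) (by simp) h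
  exact List.map_injective_iff.2 Fin.val_injective (List.reverse_injective digits_eq)

theorem ncard_levelSet_wordValue_lt (hm : 1 < m) {n c : ℕ} (hc : c ≤ m ^ n) :
    (levelSet {w : List (Fin m) | wordValue w < c} n).ncard = c := by
  have image_univ : wordValue '' levelSet (Set.univ : Set (List (Fin m))) n = Set.Iio (m ^ n) := by
    refine Set.eq_of_subset_of_ncard_le ?_ ?_ (Set.finite_Iio _)
    · rintro _ ⟨w, ⟨-, rfl⟩, rfl⟩
      exact wordValue_lt hm w
    · rw [(injOn_wordValue hm _ n).ncard_image, ncard_levelSet_univ, Set.ncard_Iio_nat]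
  have image_eq : wordValue '' levelSet {w : List (Fin m) | wordValue w < c} n = Set.Iio c := by
    refine Set.Subset.antisymm (Set.image_subset_iff.2 fun w hw => hw.1) fun k hk => ?_
    obtain ⟨w, hw, rfl⟩ := image_univ.ge (Set.mem_Iio.2 (lt_of_lt_of_le hk hc))
    exact ⟨w, ⟨hk, hw.2⟩, rfl⟩
  rw [← (injOn_wordValue hm _ n).ncard_image, image_eq, Set.ncard_Iio_nat]

/-- The words whose `m`-adic interval `[j / m ^ n, (j + 1) / m ^ n]` lies in `[0, a]`. -/
def region (a : NNReal) : Set (List (Fin m)) := {w | wordValue w < ⌊a * m ^ w.length⌋₊}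

theorem append_mem_region {a : NNReal} {w : List (Fin m)} (hw : w ∈ region a) (t : List (Fin m)) :
    w ++ t ∈ region a := by
  induction t using List.reverseRecOn with
  | nil => simpa using hw
  | append_singleton t x ih =>
    rw [region, Set.mem_ofPred_eq, ← Nat.succ_le_iff, Nat.le_floor_iff zero_le] at ih ⊢
    rw [← List.append_assoc, wordValue_concat, List.length_append (as := w ++ t),
      List.length_singleton, pow_succ]
    calc (((x + m * wordValue (w ++ t)).succ : ℕ) : NNReal)
        ≤ ((m * (wordValue (w ++ t)).succ : ℕ) : NNReal) := by
          rw [Nat.cast_le, Nat.mul_succ]; omega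
      _ = (wordValue (w ++ t)).succ * m := by rw [Nat.cast_mul, mul_comm]
      _ ≤ a * m ^ (w ++ t).length * m := by gcongr
      _ = _ := mul_assoc _ _ _

theorem ncard_levelSet_region (hm : 1 < m) {a : NNReal} (ha : a ≤ 1) (n : ℕ) :
    (levelSet (region a : Set (List (Fin m))) n).ncard = ⌊a * m ^ n⌋₊ := by
  have floor_le : ⌊a * (m : NNReal) ^ n⌋₊ ≤ m ^ n :=
    Nat.floor_le_of_le (by push_cast; exact mul_le_of_le_one_left zero_le ha)
  rw [← ncard_levelSet_wordValue_lt hm floor_le]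
  congr 1
  ext w
  exact and_congr_left fun h => by rw [region, Set.mem_ofPred_eq, h]; rfl

theorem exists_lt_ncard_levelSet_region (hm : 1 < m) {a b : NNReal} (ha : a ≤ 1) (hab : b < a) :
    ∃ k, b * m ^ k < (levelSet (region a : Set (List (Fin m))) k).ncard := by
  obtain ⟨k, hk⟩ :=
    pow_unbounded_of_one_lt (1 / (a - b)) (show (1 : NNReal) < m by exact_mod_cast hm)
  rw [div_lt_iff₀ (tsub_pos_of_lt hab), mul_tsub, lt_tsub_iff_left] at hk
  refine ⟨k, ?_⟩
  rw [ncard_levelSet_region hm ha, mul_comm]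
  exact lt_of_add_lt_add_right
    ((hk.trans_eq (mul_comm _ _)).trans (Nat.lt_floor_add_one _))

theorem ncard_levelSet_take_mem (U : Set (List (Fin m))) {k n : ℕ} (hkn : k ≤ n) :
    (levelSet {w | w.take k ∈ U} n).ncard = (levelSet U k).ncard * m ^ (n - k) := by
  rw [← ncard_levelSet_univ (n - k), ← Set.ncard_prod]
  refine (Set.ncard_congr (fun p _ => p.1 ++ p.2) ?_ ?_ ?_).symm
  · rintro ⟨u, w⟩ ⟨⟨hu, rfl⟩, -, hw⟩
    simp only at hu hw hkn
    exact ⟨by simpa using hu, by simp only [List.length_append, hw]; omega⟩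
  · rintro ⟨u, w⟩ ⟨u', w'⟩ ⟨⟨-, hu⟩, -⟩ ⟨⟨-, hu'⟩, -⟩ h
    exact Prod.ext_iff.2 (List.append_inj h (hu.trans hu'.symm))
  · rintro w ⟨hw, rfl⟩
    exact ⟨(w.take k, w.drop k), ⟨⟨hw, by simpa using hkn⟩, trivial, by simp⟩,
      List.take_append_drop k w⟩

/-- The words of `U` with no proper prefix in `U`. -/
def minimalWords {α : Type*} (U : Set (List α)) : Set (List α) :=
  {w | w ∈ U ∧ ∀ u ∈ U, u <+: w → u = w}

theorem isAntichain_minimalWords {α : Type*} (U : Set (List α)) :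
    IsAntichain (· <+: ·) (minimalWords U) :=
  fun _ hu _ hv hne h => hne (hv.2 _ hu.1 h)

theorem exists_minimalWords_prefix {α : Type*} {U : Set (List α)} {w : List α} (hw : w ∈ U) :
    ∃ v ∈ minimalWords U, v <+: w := by
  induction hn : w.length using Nat.strong_induction_on generalizing w with
  | _ n ih =>
    subst hn
    by_cases hmin : ∀ u ∈ U, u <+: w → u = w
    · exact ⟨w, ⟨hw, hmin⟩, List.prefix_rfl⟩
    · push Not at hmin
      obtain ⟨u, hu, huw, hne⟩ := hmin
      obtain ⟨v, hv, hvu⟩ := ih u.length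
        (huw.length_le.lt_of_ne fun h => hne (huw.eq_of_length h)) hu rfl
      exact ⟨v, hv, hvu.trans huw⟩

/-! ### Closed subgroups with sparse generators -/

/-- The indices of the generators: odometers below the words of the antichain, odometers below the
sites, labels at the sites, and labels at the deep sites for each residue of the level modulo
`4`. -/
abbrev GeneratorIndex (H : Subgroup (Equiv.Perm (Fin m))) : Type := H ⊕ H ⊕ Unit ⊕ H × Fin 4

section Generator

variable {z : Fin m} {σ : H} (hσ : σ.1 z ≠ z) {A : Set (List (Fin m))}
  (hA : IsAntichain (· <+: ·) A)

/-- The generators of a subgroup supported below `A` that isolates labels on all levels far below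
each word of `A`. -/
noncomputable def generator : GeneratorIndex H → iteratedWreathProduct H
  | .inl h => spread hA (odometer z h)
  | .inr (.inl h) => spread (isAntichain_familyBelow_site_append hσ hA [z]) (odometer z h)
  | .inr (.inr (.inl _)) => constantOn (familyBelow A (site z σ)) σ
  | .inr (.inr (.inr (h, e))) => constantOn (familyBelow A (deepSite z σ e)) h

theorem supportedBelow_generator : ∀ i, SupportedBelow (generator hσ hA i) A
  | .inl _ => supportedBelow_spread hA _
  | .inr (.inl _) => (supportedBelow_spread _ _).mono fun _ => exists_prefix_of_mem_familyBelow
  | .inr (.inr (.inl _)) =>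
    (supportedBelow_constantOn _ _).mono fun _ => exists_prefix_of_mem_familyBelow
  | .inr (.inr (.inr _)) =>
    (supportedBelow_constantOn _ _).mono fun _ => exists_prefix_of_mem_familyBelow

/-- The closed subgroup generated by the family `generator hσ hA`. -/
noncomputable def sparseSubgroup : Subgroup (iteratedWreathProduct H) :=
  (filtration H).closedSubgroup (Subgroup.closure (Set.range (generator hσ hA)))

theorem generator_mem_sparseSubgroup (i : GeneratorIndex H) :
    generator hσ hA i ∈ sparseSubgroup hσ hA :=
  (filtration H).le_closedSubgroup _ (Subgroup.subset_closure ⟨i, rfl⟩)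

theorem supportedBelow_of_mem_sparseSubgroup {g : iteratedWreathProduct H}
    (hg : g ∈ sparseSubgroup hσ hA) : SupportedBelow g A :=
  supportedBelow_of_mem_closedSubgroup (fun _ => supportedBelow_of_mem_closure
    (Set.forall_mem_range.2 (supportedBelow_generator hσ hA))) hg

theorem exists_isolates_sparseSubgroup (hH : MulAction.IsPretransitive H (Fin m))
    {v : List (Fin m)} (hv : v ∈ A) {N : ℕ} (hN : v.length + 4 * (Encodable.encode v + 1) + 3 ≤ N)
    {c : List (Fin m)} (hc : c.length = N / 2 + 3) :
    ∃ w, ∀ y, (v ++ c ++ y).length = N → Isolates (sparseSubgroup hσ hA) (v ++ c ++ y) w := by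
  obtain ⟨n, e, hNe⟩ : ∃ (n : ℕ) (e : Fin 4), N = v.length + 4 * n + 3 + e :=
    ⟨(N - v.length - 3) / 4, ⟨(N - v.length - 3) % 4, Nat.mod_lt _ (by norm_num)⟩, by
      dsimp only; omega⟩
  have := e.2
  have mem := generator_mem_sparseSubgroup hσ hA
  obtain ⟨w, hw⟩ := exists_isolates hσ hA hH (fun h => mem (.inl h)) (fun h => mem (.inr (.inl h)))
    (mem (.inr (.inr (.inl ())))) (fun h => mem (.inr (.inr (.inr (h, e))))) hv (n := n) (by omega)
    (c := c.take (2 * n + 3)) (by rw [List.length_take]; omega)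
  refine ⟨w, fun y hy => ?_⟩
  have isolates := hw (c.drop (2 * n + 3) ++ y) (by
    simp only [List.length_append, List.length_drop] at hy ⊢; omega)
  rwa [← List.append_assoc, List.append_assoc v, List.take_append_drop] at isolates

end Generator

theorem hasIndependentLabels_of_isolates {K : Subgroup (iteratedWreathProduct H)}
    {S : Set (List (Fin m))} {D : ℕ → Set (List (Fin m))}
    (hS : ∀ u ∈ S, ∃ w ∈ D u.length, Isolates K u w) (hD : ∀ u ∈ S, u ∉ D u.length) :
    HasIndependentLabels K S := fun u hu h => by
  obtain ⟨w, hw, isolates⟩ := hS u hu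
  obtain ⟨s, hsK, hs, hlabel⟩ := isolates h
  refine ⟨s, hsK, hs, fun v hv hvu => hlabel v hvu ?_⟩
  rintro rfl
  exact hD v hv (hvu ▸ hw)

section Partners

variable {z : Fin m} {σ : H} (hσ : σ.1 z ≠ z) (U : Set (List (Fin m)))

/-- Only the prefix of length about `N / 2` of a word determines its partner, so there are few
partners. -/
theorem exists_partners (hH : MulAction.IsPretransitive H (Fin m)) (k : ℕ) :
    ∃ C N₀ : ℕ, ∀ N ≥ N₀, ∃ D : Set (List (Fin m)), D.Finite ∧ D.ncard ≤ C * m ^ (N / 2) ∧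
      ∀ u ∈ levelSet {w | w.take k ∈ U} N, ∃ w ∈ D,
        Isolates (sparseSubgroup hσ (isAntichain_minimalWords U)) u w := by
  set B : Set (List (Fin m)) := {v | v ∈ minimalWords U ∧ v.length < k + 1}
  have finite_B : B.Finite := (List.finite_length_lt (Fin m) (k + 1)).subset fun _ h => h.2
  obtain ⟨M, hM⟩ := (finite_B.image Encodable.encode).bddAbove
  refine ⟨B.ncard * m ^ 3, 2 * k + 4 * (M + 1) + 3, fun N hN => ?_⟩
  have exists_partner : ∀ v ∈ B, ∀ c ∈ levelSet (Set.univ : Set (List (Fin m))) (N / 2 + 3),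
      ∃ w, ∀ y, (v ++ c ++ y).length = N →
        Isolates (sparseSubgroup hσ (isAntichain_minimalWords U)) (v ++ c ++ y) w := by
    intro v hv c hc
    have encode_le := hM ⟨v, hv, rfl⟩
    have := hv.2
    exact exists_isolates_sparseSubgroup hσ _ hH hv.1 (by omega) hc.2
  choose! partner hpartner using exists_partner
  have finite_prod := finite_B.prod
    (Set.toFinite (levelSet (Set.univ : Set (List (Fin m))) (N / 2 + 3)))
  refine ⟨_, finite_prod.image fun p => partner p.1 p.2, ?_, fun u ⟨huU, hu⟩ => ?_⟩
  · refine (Set.ncard_image_le finite_prod).trans_eq ?_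
    rw [Set.ncard_prod, ncard_levelSet_univ]
    ring
  · obtain ⟨v, hv, hvu⟩ := exists_minimalWords_prefix (U := U) huU
    have hvk := hvu.length_le
    rw [List.length_take] at hvk
    obtain ⟨t, rfl⟩ := hvu.trans (List.take_prefix k u)
    rw [List.length_append] at hu
    have hvB : v ∈ B := ⟨hv, by omega⟩
    have hc : t.take (N / 2 + 3) ∈ levelSet (Set.univ : Set (List (Fin m))) (N / 2 + 3) :=
      ⟨trivial, by rw [List.length_take]; omega⟩
    refine ⟨_, Set.mem_image_of_mem _ (Set.mk_mem_prod hvB hc), ?_⟩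
    simpa using hpartner v hvB _ hc (t.drop (N / 2 + 3)) (by simpa using hu)

end Partners

/-! ### Hausdorff dimension -/

theorem eventually_mul_pow_half_le {r : NNReal} (hr : 1 < r) (C : NNReal) {ε : NNReal}
    (hε : 0 < ε) : ∀ᶠ n in Filter.atTop, C * r ^ (n / 2) ≤ ε * r ^ n := by
  obtain ⟨j, hj⟩ := pow_unbounded_of_one_lt (C / ε) hr
  rw [div_lt_iff₀ hε] at hj
  filter_upwards [Filter.eventually_ge_atTop (2 * j)] with n hn
  calc C * r ^ (n / 2) ≤ r ^ j * ε * r ^ (n / 2) := by gcongr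
    _ = ε * r ^ (j + n / 2) := by ring
    _ ≤ ε * r ^ n := by gcongr; exacts [hr.le, by omega]

theorem exists_sum_range_le_add {f g : ℕ → NNReal} (h : ∀ᶠ k in Filter.atTop, f k ≤ g k) :
    ∃ C, ∀ n, ∑ k ∈ Finset.range n, f k ≤ C + ∑ k ∈ Finset.range n, g k := by
  obtain ⟨N, hN⟩ := Filter.eventually_atTop.1 h
  refine ⟨∑ k ∈ Finset.range N, f k, fun n => ?_⟩
  rw [← Finset.sum_filter_add_sum_filter_not (Finset.range n) (· < N)]
  gcongr ?_ + ?_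
  · exact Finset.sum_le_sum_of_subset fun k hk => by simp_all
  · exact (Finset.sum_le_sum fun k hk => hN k (not_lt.1 (Finset.mem_filter.1 hk).2)).trans
      (Finset.sum_le_sum_of_subset (Finset.filter_subset _ _))

theorem exists_hasIndependentLabels (hH : MulAction.IsPretransitive H (Fin m)) {z : Fin m} {σ : H}
    (hσ : σ.1 z ≠ z) {U : Set (List (Fin m))} {b : NNReal} {k : ℕ}
    (hk : b * m ^ k < (levelSet U k).ncard) :
    ∃ S, HasIndependentLabels (sparseSubgroup hσ (isAntichain_minimalWords U)) S ∧
      ∀ᶠ n in Filter.atTop, b * m ^ n ≤ (levelSet S n).ncard := by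
  have hm : (1 : NNReal) < m := by
    have : Nontrivial (Fin m) := ⟨_, _, hσ⟩
    exact_mod_cast Fin.nontrivial_iff_two_le.1 this
  obtain ⟨C, N₀, exists_D⟩ := exists_partners hσ U hH k
  choose! D finite_D ncard_D hD using exists_D
  refine ⟨{w | N₀ ≤ w.length ∧ w.take k ∈ U ∧ w ∉ D w.length},
    hasIndependentLabels_of_isolates (fun u hu => hD _ hu.1 u ⟨hu.2.1, rfl⟩) fun u hu => hu.2.2, ?_⟩
  obtain ⟨ε, hε, add_eq⟩ := exists_pos_add_of_lt' hk
  filter_upwards [eventually_mul_pow_half_le hm C (div_pos hε (pow_pos (one_pos.trans hm) k)),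
    Filter.eventually_ge_atTop N₀, Filter.eventually_ge_atTop k] with n hn hN₀ hkn
  have ncard_le : (levelSet U k).ncard * m ^ (n - k) ≤
      (levelSet {w | N₀ ≤ w.length ∧ w.take k ∈ U ∧ w ∉ D w.length} n).ncard +
        C * m ^ (n / 2) := by
    rw [← ncard_levelSet_take_mem U hkn]
    refine (Set.ncard_le_ncard_sdiff_add_ncard _ (D n) (finite_D n hN₀)).trans
      (add_le_add (Set.ncard_le_ncard ?_ (Set.toFinite _)) (ncard_D n hN₀))
    rintro w ⟨⟨hw, rfl⟩, hwD⟩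
    exact ⟨⟨hN₀, hw, hwD⟩, rfl⟩
  have pow_eq : (m : NNReal) ^ n = m ^ k * m ^ (n - k) := by
    rw [← pow_add, Nat.add_sub_cancel' hkn]
  refine le_of_add_le_add_right (a := ε * m ^ (n - k)) ?_
  calc b * m ^ n + ε * m ^ (n - k) = (levelSet U k).ncard * m ^ (n - k) := by
        rw [← add_eq, pow_eq]; ring
    _ ≤ (levelSet {w | N₀ ≤ w.length ∧ w.take k ∈ U ∧ w ∉ D w.length} n).ncard +
          C * m ^ (n / 2) := by exact_mod_cast ncard_le
    _ ≤ _ + ε / m ^ k * m ^ n := by gcongr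
    _ = _ + ε * m ^ (n - k) := by
        rw [pow_eq, ← mul_assoc, div_mul_cancel₀ ε (pow_pos (one_pos.trans hm) k).ne']

theorem tendsto_index_term [Nontrivial H] :
    Filter.Tendsto (fun n => ((filtration H).term n).index) Filter.atTop Filter.atTop := by
  obtain ⟨σ, τ, hne⟩ := exists_pair_ne H
  obtain ⟨z, -⟩ : ∃ z, σ.1 z ≠ τ.1 z := by
    by_contra! h
    exact hne (Subtype.ext (Equiv.ext h))
  refine Filter.tendsto_atTop_mono (fun n => ?_) Filter.tendsto_id
  have le_sum : n ≤ ∑ k ∈ Finset.range n, m ^ k := by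
    simpa using Finset.card_nsmul_le_sum (Finset.range n) (m ^ ·) 1
      fun k _ => Nat.one_le_pow _ _ z.pos
  rw [index_term]
  exact le_sum.trans (Nat.lt_pow_self Finite.one_lt_card).le

theorem cast_card_pow (k : ℕ) :
    ((Nat.card H ^ k : ℕ) : ℝ≥0∞) = (Nat.card H : ℝ≥0∞) ^ (k : ℝ) := by
  rw [ENNReal.rpow_natCast, Nat.cast_pow]

theorem hdim_le_of_label_eq_one [Nontrivial H] {K : Subgroup (iteratedWreathProduct H)}
    {U : Set (List (Fin m))} (hK : ∀ g ∈ K, ∀ w ∉ U, label g w = 1) {a : NNReal}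
    (hU : ∀ n, (levelSet U n).ncard ≤ a * m ^ n) : (filtration H).hdim K ≤ a := by
  refine (filtration H).hdim_le tendsto_index_term (Filter.Frequently.of_forall fun n => ?_)
  have sum_le : ((∑ k ∈ Finset.range n, (levelSet U k).ncard : ℕ) : NNReal) ≤
      (∑ k ∈ Finset.range n, m ^ k : ℕ) * a := by
    push_cast
    rw [Finset.sum_mul]
    exact Finset.sum_le_sum fun k _ => (hU k).trans_eq (mul_comm _ _)
  calc (((filtration H).term n).relIndex K : ℝ≥0∞)
      ≤ (Nat.card H ^ ∑ k ∈ Finset.range n, (levelSet U k).ncard : ℕ) :=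
        Nat.cast_le.2 (relIndex_le hK n)
    _ ≤ (Nat.card H : ℝ≥0∞) ^ ((∑ k ∈ Finset.range n, m ^ k : ℕ) * a : ℝ) := by
        rw [cast_card_pow]
        exact ENNReal.rpow_le_rpow_of_exponent_le (by exact_mod_cast Nat.card_pos)
          (by exact_mod_cast sum_le)
    _ = _ := by rw [index_term, cast_card_pow, ENNReal.rpow_mul]

theorem HasIndependentLabels.le_hdim [Nontrivial H] {K : Subgroup (iteratedWreathProduct H)}
    {S : Set (List (Fin m))} (hS : HasIndependentLabels K S)
    (hK : (filtration H).IsClosedSubgroup K) {b : NNReal}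
    (hb : ∀ᶠ n in Filter.atTop, b * m ^ n ≤ (levelSet S n).ncard) : b ≤ (filtration H).hdim K := by
  obtain ⟨C, hC⟩ := exists_sum_range_le_add hb
  refine (filtration H).le_hdim tendsto_index_term compactSpace hK
    (C := (Nat.card H : NNReal) ^ (C : ℝ)) fun n => ?_
  have sum_le : ((∑ k ∈ Finset.range n, m ^ k : ℕ) : NNReal) * b ≤
      C + (∑ k ∈ Finset.range n, (levelSet S k).ncard : ℕ) := by
    push_cast
    rw [mul_comm, Finset.mul_sum]
    exact hC n
  have card_ne_zero : (Nat.card H : NNReal) ≠ 0 := by exact_mod_cast Nat.card_pos.ne'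
  calc (((filtration H).term n).index : ℝ≥0∞) ^ (b : ℝ)
      = (Nat.card H : ℝ≥0∞) ^ ((∑ k ∈ Finset.range n, m ^ k : ℕ) * b : ℝ) := by
        rw [index_term, cast_card_pow, ENNReal.rpow_mul]
    _ ≤ (Nat.card H : ℝ≥0∞) ^ (C + (∑ k ∈ Finset.range n, (levelSet S k).ncard : ℕ) : ℝ) :=
        ENNReal.rpow_le_rpow_of_exponent_le (by exact_mod_cast Nat.card_pos)
          (by exact_mod_cast sum_le)
    _ = ((Nat.card H : NNReal) ^ (C : ℝ) : NNReal) *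
          (Nat.card H ^ ∑ k ∈ Finset.range n, (levelSet S k).ncard : ℕ) := by
        rw [ENNReal.rpow_add_of_nonneg (C : ℝ) _ C.coe_nonneg (Nat.cast_nonneg _), cast_card_pow,
          ENNReal.coe_rpow_of_ne_zero card_ne_zero, ENNReal.coe_natCast]
    _ ≤ _ := by gcongr; exact hS.le_relIndex n

theorem hdim_sparseSubgroup_region (hH : MulAction.IsPretransitive H (Fin m)) {z : Fin m} {σ : H}
    (hσ : σ.1 z ≠ z) {a : NNReal} (ha : a ≤ 1) :
    (filtration H).hdim (sparseSubgroup hσ (isAntichain_minimalWords (region a))) = a := by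
  have : Nontrivial (Fin m) := ⟨_, _, hσ⟩
  have : Nontrivial H := ⟨σ, 1, fun h => hσ (by rw [h]; rfl)⟩
  have hm : 1 < m := Fin.nontrivial_iff_two_le.1 ‹_›
  refine le_antisymm (hdim_le_of_label_eq_one (U := region a) (fun g hg w hw => ?_) fun n => ?_)
    (ENNReal.le_of_forall_nnreal_lt fun b hb => ?_)
  · refine supportedBelow_of_mem_sparseSubgroup _ _ hg w fun v hv => ?_
    rintro ⟨t, rfl⟩
    exact hw (append_mem_region hv.1 t)
  · rw [ncard_levelSet_region hm ha]
    exact Nat.floor_le zero_le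
  · obtain ⟨k, hk⟩ := exists_lt_ncard_levelSet_region hm ha (ENNReal.coe_lt_coe.1 hb)
    obtain ⟨S, hS, eventually_le⟩ := exists_hasIndependentLabels hH hσ hk
    exact hS.le_hdim ((filtration H).isClosedSubgroup_closedSubgroup _) eventually_le

theorem Icc_subset_hspecBounded (hH : MulAction.IsPretransitive H (Fin m)) {z : Fin m} {σ : H}
    (hσ : σ.1 z ≠ z) :
    Set.Icc 0 1 ⊆ (filtration H).hspecBounded (Nat.card (GeneratorIndex H)) := by
  rintro d ⟨-, hd⟩
  lift d to NNReal using ne_top_of_le_ne_top ENNReal.one_ne_top hd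
  have finite_range := Set.finite_range (generator hσ (isAntichain_minimalWords (region d)))
  refine ⟨_, (filtration H).isClosedSubgroup_closedSubgroup _, ⟨finite_range.toFinset, ?_, ?_⟩,
    hdim_sparseSubgroup_region hH hσ (ENNReal.coe_le_one_iff.1 hd)⟩
  · exact (Set.ncard_eq_toFinset_card _ finite_range).symm.trans_le (Finite.card_range_le _)
  · rw [finite_range.coe_toFinset]
    rfl

end iteratedWreathProduct

open iteratedWreathProduct in
theorem mainTheorem2 (m : ℕ) (hm : 2 ≤ m) (H : Subgroup (Equiv.Perm (Fin m)))
    (hH : MulAction.IsPretransitive H (Fin m)) :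
    ∃ b : ℕ, 2 ≤ b ∧
      (TreeAut.levelFiltration (iteratedWreathProduct H)).hspecBounded b = Set.Icc 0 1 ∧
      (TreeAut.levelFiltration (iteratedWreathProduct H)).hspecFG = Set.Icc 0 1 ∧
      (TreeAut.levelFiltration (iteratedWreathProduct H)).hspec = Set.Icc 0 1 := by
  have : Nontrivial (Fin m) := Fin.nontrivial_iff_two_le.2 hm
  obtain ⟨z, σ, hσ⟩ : ∃ (z : Fin m) (σ : H), σ.1 z ≠ z := exists_smul_ne H (Fin m)
  have : Nontrivial H := ⟨σ, 1, fun h => hσ (by rw [h]; rfl)⟩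
  have : Nontrivial (GeneratorIndex H) := Sum.inl_injective.nontrivial
  have bounded_subset_fg := (filtration H).hspecBounded_subset_hspecFG (Nat.card (GeneratorIndex H))
  have fg_subset := (filtration H).hspecFG_subset_hspec
  have subset_Icc : (filtration H).hspec ⊆ Set.Icc 0 1 := by
    rintro _ ⟨K, -, rfl⟩
    exact ⟨zero_le, (filtration H).hdim_le_one tendsto_index_term K⟩
  have Icc_subset := Icc_subset_hspecBounded hH hσ
  exact ⟨Nat.card (GeneratorIndex H), Finite.one_lt_card,
    (bounded_subset_fg.trans (fg_subset.trans subset_Icc)).antisymm Icc_subset,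
    (fg_subset.trans subset_Icc).antisymm (Icc_subset.trans bounded_subset_fg),
    subset_Icc.antisymm (Icc_subset.trans (bounded_subset_fg.trans fg_subset))⟩
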